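/- **Theorem (GNZ equations, infinite volume).** Let $d\ge 1$, let $\mathcal C$ be the space of locally finite subsets of $\mathbb R^d$ with the $\sigma$-field generated by the counting functions $N_\Lambda(\gamma)=\#(\gamma\cap\Lambda)$, $\Lambda$ bounded Borel, let $\mathcal C_f\subset\mathcal C$ be the set of finite configurations, and write $\gamma_\Lambda=\gamma\cap\Lambda$. Let $B(x,R)$ be the closed ball, and use the convention $\infty-\infty=0$ (and $0\cdot\infty=0$). Let $H:\mathcal C_f\to\mathbb R\cup\{+\infty\}$ be an energy function: $H$ is measurable, $H(\emptyset)<\infty$; $H(\gamma)<\infty$ implies $H(\gamma\setminus\{x\})<\infty$ for $x\in\gamma$; and there is $A\in\mathbb R$ with $H(\gamma)\ge A\,\#\gamma$ for all $\gamma\in\mathcal C_f$. For bounded $\Delta$ and $\gamma\in\mathcal C_f$ put $H_\Delta(\gamma)=H(\gamma)-H(\gamma_{\Delta^c})$, and put $h(x,\gamma)=H(\{x\}\cup\gamma)-H(\gamma)$. Assume that $H$ has finite range $R>0$: for every bounded $\Delta$ and every $\gamma\in\mathcal C_f$ with $H(\gamma_{\Delta^c})<\infty$, $H_\Delta(\gamma)=H_\Delta(\gamma_{\Delta\oplus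 B(0,R)})$. Extend $H_\Delta$ and $h$ to all $\gamma\in\mathcal C$ by $H_\Delta(\gamma):=H_\Delta(\gamma_{\Delta\oplus B(0,R)})$ and $h(x,\gamma):=h(x,\gamma_{B(x,R)})$. Let $z>0$, $\beta\ge0$, and let $P$ be a probability measure on $\mathcal C$. Call $P$ an infinite-volume Gibbs measure with energy function $H$, activity $z$ and inverse temperature $\beta$ if for every bounded Borel set $\Delta$ of positive Lebesgue measure, for $P$-almost every $\gamma_{\Delta^c}$, $$P(d\gamma_\Delta\mid\gamma_{\Delta^c})=\frac1{Z_\Delta^{z,\beta}(\gamma_{\Delta^c})}\,z^{N_\Delta(\gamma)}e^{-\beta H_\Delta(\gamma)}\,\pi_\Delta(d\gamma_\Delta),$$ where $\pi_\Delta$ is the law of the Poisson point process of intensity $1$ in $\Delta$ and $Z_\Delta^{z,\beta}(\gamma_{\Delta^c})$ is the normalizing constant. (Neither $H$ nor $P$ is required to be stationary.) Then $P$ is an infinite-volume Gibbs measure with energy function $H$, activity $z$ and inverse temperature $\beta$ if and only if, for every nonnegative measurable function $f:\mathbb R^d\times\mathcal C\to\mathbb R$, $$\int\sum_{x\in\gamma}f(x,\gamma\setminus\{x\})\,P(d\gamma)=z\int\int_{\mathbb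 R^d}f(x,\gamma)\,e^{-\beta h(x,\gamma)}\,dx\,P(d\gamma),$$ where both sides may be $+\infty$. -/

import Mathlib

open MeasureTheory Set
open scoped ENNReal NNReal Pointwise

noncomputable section

/-- The space `ℝ^d` with its Euclidean norm and Lebesgue measure. -/
abbrev Point (d : ℕ) : Type := EuclideanSpace ℝ (Fin d)

/-- The space `𝒞` of configurations: locally finite subsets of `ℝ^d`. -/
@[ext]
structure Config (d : ℕ) where
  carrier : Set (Point d)
  finite_inter : ∀ Λ : Set (Point d), Bornology.IsBounded Λ → (carrier ∩ Λ).Finite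

namespace Config

variable {d : ℕ}

/-- The counting function `N_Λ(γ) = #(γ ∩ Λ)`; only used where `γ ∩ Λ` is finite. -/
def count (Λ : Set (Point d)) (γ : Config d) : ℕ := (γ.carrier ∩ Λ).ncard

/-- The σ-field generated by the counting functions of bounded Borel sets. -/
instance instMeasurableSpace : MeasurableSpace (Config d) :=
  ⨆ (Λ : Set (Point d)) (_ : Bornology.IsBounded Λ) (_ : MeasurableSet Λ),
    MeasurableSpace.comap (count Λ) ⊤

/-- A finite set of points, as a configuration. -/
def ofFinite (s : Set (Point d)) (hs : s.Finite) : Config d :=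
  ⟨s, fun _ _ => hs.subset inter_subset_left⟩

/-- The restriction `γ_Λ = γ ∩ Λ`. -/
def restrict (γ : Config d) (Λ : Set (Point d)) : Config d :=
  ⟨γ.carrier ∩ Λ, fun B hB => (γ.finite_inter B hB).subset (by
    rintro x ⟨⟨h1, _⟩, h2⟩; exact ⟨h1, h2⟩)⟩

/-- The union `γ ∪ γ'`. -/
def union (γ γ' : Config d) : Config d :=
  ⟨γ.carrier ∪ γ'.carrier, fun B hB => by
    rw [union_inter_distrib_right]
    exact (γ.finite_inter B hB).union (γ'.finite_inter B hB)⟩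

/-- The configuration `γ \ {x}`. -/
def erase (γ : Config d) (x : Point d) : Config d :=
  ⟨γ.carrier \ {x}, fun B hB => (γ.finite_inter B hB).subset (by
    rintro y ⟨⟨h1, _⟩, h2⟩; exact ⟨h1, h2⟩)⟩

end Config

/-- The space `𝒞_f` of finite configurations, with the trace σ-field. -/
abbrev FinConfig (d : ℕ) : Type := {γ : Config d // γ.carrier.Finite}

namespace FinConfig

variable {d : ℕ}

/-- The empty configuration. -/
def empty : FinConfig d := ⟨Config.ofFinite ∅ finite_empty, finite_empty⟩

/-- The number of points of a finite configuration. -/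
def card (γ : FinConfig d) : ℕ := γ.1.carrier.ncard

/-- The restriction `γ_Λ = γ ∩ Λ`. -/
def restrict (γ : FinConfig d) (Λ : Set (Point d)) : FinConfig d :=
  ⟨γ.1.restrict Λ, γ.2.subset inter_subset_left⟩

/-- The configuration `γ \ {x}`. -/
def erase (γ : FinConfig d) (x : Point d) : FinConfig d :=
  ⟨γ.1.erase x, γ.2.subset sdiff_subset⟩

/-- The configuration `{x} ∪ γ`. -/
def insert (x : Point d) (γ : FinConfig d) : FinConfig d :=
  ⟨(Config.ofFinite {x} (finite_singleton x)).union γ.1, (finite_singleton x).union γ.2⟩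

end FinConfig

/-- The restriction `γ_Λ` of an arbitrary configuration to a bounded set is finite. -/
def Config.restrictBounded {d : ℕ} (γ : Config d) (Λ : Set (Point d))
    (hΛ : Bornology.IsBounded Λ) : FinConfig d :=
  ⟨γ.restrict Λ, γ.finite_inter Λ hΛ⟩

/-- An energy function: a measurable `H : 𝒞_f → ℝ ∪ {+∞}` which is non-degenerate,
hereditary and stable. -/
structure IsEnergyFunction {d : ℕ} (H : FinConfig d → EReal) : Prop where
  measurable : Measurable H
  ne_bot : ∀ γ, H γ ≠ ⊥
  nondegenerate : H FinConfig.empty ≠ ⊤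
  hereditary : ∀ (γ : FinConfig d), ∀ x ∈ γ.1.carrier, H γ ≠ ⊤ → H (γ.erase x) ≠ ⊤
  stable : ∃ A : ℝ, ∀ γ : FinConfig d, ((A * (γ.card : ℝ) : ℝ) : EReal) ≤ H γ

open Classical in
/-- The difference `a - b` of energies, with the convention `∞ - ∞ = 0`. -/
def energySub (a b : EReal) : EReal := if a = ⊤ ∧ b = ⊤ then 0 else a - b

/-- `H_Δ(γ) = H(γ) - H(γ_{Δᶜ})` for a finite configuration `γ`. -/
def deltaEnergyFin {d : ℕ} (H : FinConfig d → EReal) (Δ : Set (Point d))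
    (γ : FinConfig d) : EReal :=
  energySub (H γ) (H (γ.restrict Δᶜ))

/-- `H` has finite range `R`: for every bounded `Δ` and every finite `γ`,
`H_Δ(γ) = H_Δ(γ_{Δ ⊕ B(0,R)})`. The identity is required when the energy `H(γ_{Δᶜ})` that is
subtracted is finite; otherwise `H_Δ(γ)` is the conventional value of `∞ - ∞`, and the identity
would fail for hard-core interactions. -/
def HasFiniteRange {d : ℕ} (H : FinConfig d → EReal) (R : ℝ) : Prop :=
  ∀ Δ : Set (Point d), Bornology.IsBounded Δ → ∀ γ : FinConfig d, H (γ.restrict Δᶜ) ≠ ⊤ →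
    deltaEnergyFin H Δ γ = deltaEnergyFin H Δ (γ.restrict (Δ + Metric.closedBall 0 R))

/-- The extension of `H_Δ` to all configurations through `H_Δ(γ) = H_Δ(γ_{Δ ⊕ B(0,R)})`. -/
def deltaEnergy {d : ℕ} (H : FinConfig d → EReal) (R : ℝ) (Δ : Set (Point d))
    (hΔ : Bornology.IsBounded Δ) (γ : Config d) : EReal :=
  deltaEnergyFin H Δ
    (γ.restrictBounded (Δ + Metric.closedBall 0 R) (hΔ.add Metric.isBounded_closedBall))

/-- The local energy `h(x,γ) = H({x} ∪ γ) - H(γ)` of `x` in a finite configuration. -/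
def localEnergyFin {d : ℕ} (H : FinConfig d → EReal) (x : Point d) (γ : FinConfig d) : EReal :=
  energySub (H (FinConfig.insert x γ)) (H γ)

/-- The extension of the local energy to all configurations: `h(x,γ) = h(x,γ_{B(x,R)})`. -/
def localEnergy {d : ℕ} (H : FinConfig d → EReal) (R : ℝ) (x : Point d) (γ : Config d) : EReal :=
  localEnergyFin H x (γ.restrictBounded (Metric.closedBall x R) Metric.isBounded_closedBall)

/-- The Boltzmann factor `e^{-βu}`, with `e^{-β·∞} = 0` for `β > 0` and `e^{-0·∞} = 1`. -/
def boltzmann (β : ℝ) (u : EReal) : ℝ≥0∞ := EReal.exp (-((β : EReal) * u))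

/-- The law `π_Δ` of the Poisson point process with unit intensity in a bounded set `Δ`: the number
of points is `n` with probability `e^{-|Δ|} |Δ|^n / n!`, and given this number the points are
independent and uniform in `Δ`. -/
def poissonLaw {d : ℕ} (Δ : Set (Point d)) : Measure (Config d) :=
  Measure.sum fun n : ℕ =>
    (ENNReal.ofReal (Real.exp (-(volume Δ).toReal)) / (n.factorial : ℝ≥0∞)) •
      (Measure.pi fun _ : Fin n => (volume : Measure (Point d)).restrict Δ).map
        fun x => Config.ofFinite (Set.range x) (Set.finite_range x)

/-- The unnormalized density `γ' ↦ z^{N_Δ(γ')} e^{-β H_Δ(γ'_Δ ∪ γ_{Δᶜ})}`. -/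
def gibbsWeight {d : ℕ} (H : FinConfig d → EReal) (R z β : ℝ) (Δ : Set (Point d))
    (hΔ : Bornology.IsBounded Δ) (γ γ' : Config d) : ℝ≥0∞ :=
  ENNReal.ofReal z ^ (γ'.count Δ) *
    boltzmann β (deltaEnergy H R Δ hΔ ((γ'.restrict Δ).union (γ.restrict Δᶜ)))

/-- The partition function `Z_Δ(γ_{Δᶜ})`. -/
def partitionFunction {d : ℕ} (H : FinConfig d → EReal) (R z β : ℝ) (Δ : Set (Point d))
    (hΔ : Bornology.IsBounded Δ) (γ : Config d) : ℝ≥0∞ :=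
  ∫⁻ γ', gibbsWeight H R z β Δ hΔ γ γ' ∂(poissonLaw Δ)

/-- The local Gibbs distribution in `Δ` given the configuration `γ_{Δᶜ}` outside:
`Z_Δ(γ_{Δᶜ})⁻¹ z^{N_Δ(γ')} e^{-β H_Δ(γ' ∪ γ_{Δᶜ})} π_Δ(dγ')`. -/
def gibbsKernel {d : ℕ} (H : FinConfig d → EReal) (R z β : ℝ) (Δ : Set (Point d))
    (hΔ : Bornology.IsBounded Δ) (γ : Config d) : Measure (Config d) :=
  (partitionFunction H R z β Δ hΔ γ)⁻¹ •
    (poissonLaw Δ).withDensity (gibbsWeight H R z β Δ hΔ γ)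

/-- `P` is an infinite-volume Gibbs measure (DLR equations): for every bounded Borel set `Δ` with
positive Lebesgue measure, `γ ↦ gibbsKernel … γ`, which is a function of `γ_{Δᶜ}`, is a version of
the conditional distribution of `γ_Δ` given `γ_{Δᶜ}` under `P`, that is, for all measurable `A`, `B`,
`P(γ_Δ ∈ A, γ_{Δᶜ} ∈ B) = ∫ 1_{γ_{Δᶜ} ∈ B} gibbsKernel(γ_{Δᶜ}, A) P(dγ)`. -/
def IsGibbsMeasure {d : ℕ} (H : FinConfig d → EReal) (R z β : ℝ) (P : Measure (Config d)) : Prop :=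
  ∀ (Δ : Set (Point d)) (hΔ : Bornology.IsBounded Δ), MeasurableSet Δ → 0 < volume Δ →
    ∀ A B : Set (Config d), MeasurableSet A → MeasurableSet B →
      P {γ | γ.restrict Δ ∈ A ∧ γ.restrict Δᶜ ∈ B} =
        ∫⁻ γ in {γ | γ.restrict Δᶜ ∈ B}, gibbsKernel H R z β Δ hΔ γ A ∂P

end

/-!
The DLR and the GNZ equations both describe `P` through the way in which the weight
`V = z^{N_Δ} e^{-β H_Δ}` changes when a point is added. A measure satisfying GNZ is one whose reduced
Campbell measure `∑_{x ∈ γ} δ_{(x, γ \ {x})} P(dγ)` has the density `z e^{-β h(x, γ)}` with respect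
to `dx ⊗ P` (`gnz_iff_hasCampbellDensity`). Two facts connect this with DLR: the Mecke formula for
the Poisson process in `Δ` (`Config.lintegral_poissonLaw_mecke`) and the identity
`V(γ ∪ {x}) = z e^{-β h(x, γ)} V(γ)` for `x ∈ Δ` (`windowWeight_add`), which is the finite range
property applied to `{x}`.

The identity needs `H(γ_{Δᶜ})` to be finite: otherwise the convention `∞ - ∞ = 0` replaces the
energy of `Δ`, and it may fail for hard-core interactions. So each direction first has to show that
`H(γ_Λ) < ∞` for all bounded `Λ`, almost surely. Both arguments use that null sets remain null when
points are removed (`RemovalStable`), which holds as soon as the reduced Campbell measure has some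
density.

* DLR to GNZ. The Mecke formula, applied inside the DLR equation in a ball `Δ`, gives the density
  `V(γ ∪ {x}) / V(γ)` without any finiteness of energies (`IsGibbsMeasure.hasCampbellDensity`), since
  the zeros of `V` persist when points are added. As `V > 0` almost surely, removing the points of
  the boundary layer of `Δ` shows that `H(γ_Δ)` is finite, and then the density is `z e^{-β h}`.
* GNZ to DLR. Almost surely `e^{-β h(x, γ \ {x})} > 0` for all `x ∈ γ`, also after removal of any
  finite set of points; inserting the points of `γ_Λ` one at a time shows that its energy is finite
  (`locallyFiniteEnergy_of_removal`). The integrals over `{N_Δ = n}` of `P`, and of the weight `V`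
  with respect to the Poisson process inside `Δ` and `P` restricted to `{N_Δ = 0}` outside, obey the
  same recursion in `n`. Hence `P` is a mixture of the measures `V dπ_Δ` over the configurations
  without points in `Δ` (`HasCampbellDensity.lintegral_eq`), and its conditional laws in `Δ` are the
  normalized ones.

The Minkowski sum of a Borel set `Δ` and a closed ball need not be Borel, so `H_Δ` need not be a
measurable function of the configuration. Energies are therefore computed in a measurable window
`Λ` containing this sum (`windowWeight`); by finite range the value is the same wherever the energy
is locally finite.
-/

/-! ### Configurations as counting measures -/

namespace Config

variable {d : ℕ}

/-- A countable measurable partition of `ℝ^d` into bounded pieces. -/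
def shell (d n : ℕ) : Set (Point d) := {y | ⌊‖y‖⌋₊ = n}

theorem isBounded_shell (n : ℕ) : Bornology.IsBounded (shell d n) := by
  refine (Metric.isBounded_closedBall (x := (0 : Point d)) (r := n + 1)).subset fun y hy => ?_
  have h := Nat.lt_floor_add_one ‖y‖
  rw [show ⌊‖y‖⌋₊ = n from hy] at h
  simpa using h.le

theorem measurableSet_shell (n : ℕ) : MeasurableSet (shell d n) :=
  (Nat.measurable_floor.comp measurable_norm) (measurableSet_singleton n)

theorem iUnion_shell : ⋃ n, shell d n = univ := by
  ext y; simp [shell]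

theorem pairwise_disjoint_shell : Pairwise (Function.onFun Disjoint (shell d)) := by
  intro m n hmn
  refine Set.disjoint_left.2 fun y hm hn => hmn ?_
  exact (show ⌊‖y‖⌋₊ = m from hm).symm.trans hn

theorem countable_carrier (γ : Config d) : γ.carrier.Countable := by
  rw [← inter_univ γ.carrier, ← iUnion_shell, inter_iUnion]
  exact countable_iUnion fun n => (γ.finite_inter _ (isBounded_shell n)).countable

/-- The counting measure `∑_{x ∈ γ} δ_x` of a configuration. -/
noncomputable def points (γ : Config d) : Measure (Point d) := Measure.count.restrict γ.carrier

theorem lintegral_points (γ : Config d) (f : Point d → ℝ≥0∞) :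
    ∫⁻ x, f x ∂γ.points = ∑' x : γ.carrier, f x := by
  rw [points, lintegral_countable _ γ.countable_carrier]
  simp

theorem ae_points_iff (γ : Config d) (p : Point d → Prop) :
    (∀ᵐ x ∂γ.points, p x) ↔ ∀ x ∈ γ.carrier, p x := by
  rw [points, ae_restrict_iff'₀ γ.countable_carrier.measurableSet.nullMeasurableSet,
    Measure.ae_count_iff]

theorem points_apply (γ : Config d) {Λ : Set (Point d)} (hb : Bornology.IsBounded Λ)
    (hm : MeasurableSet Λ) : γ.points Λ = γ.count Λ := by
  rw [points, Measure.restrict_apply hm, inter_comm, count,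
    Measure.count_apply_finite _ (γ.finite_inter Λ hb),
    Set.ncard_eq_toFinset_card _ (γ.finite_inter Λ hb)]

theorem lintegral_points_singleton (γ : Config d) {x : Point d} (hx : γ.carrier = {x})
    (f : Point d → ℝ≥0∞) : ∫⁻ y, f y ∂γ.points = f x := by
  rw [points, hx, Measure.restrict_singleton]
  simp

theorem setLIntegral_points (γ : Config d) {Λ : Set (Point d)} (hm : MeasurableSet Λ)
    (f : Point d → ℝ≥0∞) : ∫⁻ x in Λ, f x ∂γ.points = ∫⁻ x, f x ∂(γ.restrict Λ).points := by
  rw [points, points, Measure.restrict_restrict hm, inter_comm]; rfl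

theorem measurable_count {Λ : Set (Point d)} (hb : Bornology.IsBounded Λ)
    (hm : MeasurableSet Λ) : Measurable (count Λ) := by
  rw [measurable_iff_comap_le]
  exact le_iSup_of_le Λ (le_iSup_of_le hb (le_iSup_of_le hm le_rfl))

/-- Measurability of a configuration-valued map is tested on the counting functions. -/
theorem measurable_of_count {X : Type*} [MeasurableSpace X] {φ : X → Config d}
    (h : ∀ Λ : Set (Point d), Bornology.IsBounded Λ → MeasurableSet Λ →
      Measurable fun x => (φ x).points Λ) : Measurable φ := by
  rw [measurable_iff_comap_le]
  simp only [instMeasurableSpace, MeasurableSpace.comap_iSup, iSup_le_iff]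
  intro Λ hb hm
  rw [MeasurableSpace.comap_comp, ← measurable_iff_comap_le]
  have h1 := (h Λ hb hm).ennreal_toReal
  refine measurable_to_countable' fun n => ?_
  convert h1 (measurableSet_singleton (n : ℝ)) using 1
  ext x
  simp [points_apply _ hb hm]

theorem measurable_points : Measurable (points : Config d → Measure (Point d)) := by
  refine Measure.measurable_of_measurable_coe _ fun s hs => ?_
  have h : ∀ γ : Config d, γ.points s = ∑' n, (γ.count (s ∩ shell d n) : ℝ≥0∞) := by
    intro γ
    conv_lhs => rw [← inter_univ s, ← iUnion_shell, inter_iUnion]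
    rw [measure_iUnion]
    · exact tsum_congr fun n => points_apply _ ((isBounded_shell n).subset inter_subset_right)
        (hs.inter (measurableSet_shell n))
    · exact fun m n hmn => (pairwise_disjoint_shell hmn).mono inter_subset_right inter_subset_right
    · exact fun n => hs.inter (measurableSet_shell n)
  simp_rw [h]
  refine Measurable.tsum fun n => ?_
  exact (measurable_from_top (f := fun k : ℕ => (k : ℝ≥0∞))).comp (measurable_count
    ((isBounded_shell n).subset inter_subset_right) (hs.inter (measurableSet_shell n)))

variable (d) in
/-- The kernel sending a configuration to its counting measure. -/
noncomputable def pointsKernel : ProbabilityTheory.Kernel (Config d) (Point d) :=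
  ⟨points, measurable_points⟩

theorem pointsKernel_apply (γ : Config d) : pointsKernel d γ = γ.points := rfl

/-- The number of points in a bounded set is finite but not uniformly bounded in the configuration,
so the kernel is cut both in space, along the shells, and along the number of points in a shell. -/
instance : ProbabilityTheory.IsSFiniteKernel (pointsKernel d) := by
  classical
  have hs : ∀ n k : ℕ, MeasurableSet {γ : Config d | γ.count (shell d n) = k} := fun n k =>
    measurable_count (isBounded_shell n) (measurableSet_shell n) (measurableSet_singleton k)
  let κ : ℕ × ℕ → ProbabilityTheory.Kernel (Config d) (Point d) := fun p =>
    ProbabilityTheory.Kernel.piecewise (hs p.1 p.2)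
      ((pointsKernel d).restrict (measurableSet_shell p.1)) 0
  have hκ : ∀ p, ProbabilityTheory.IsFiniteKernel (κ p) := by
    rintro ⟨n, k⟩
    refine ⟨⟨k, by simp, fun γ => ?_⟩⟩
    simp only [κ, ProbabilityTheory.Kernel.piecewise_apply]
    split_ifs with h
    · rw [ProbabilityTheory.Kernel.restrict_apply, Measure.restrict_apply_univ,
        pointsKernel_apply, points_apply _ (isBounded_shell n) (measurableSet_shell n)]
      rw [show γ.count (shell d n) = k from h]
    · simp
  have hsum : pointsKernel d = ProbabilityTheory.Kernel.sum κ := by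
    ext γ s h_s
    rw [ProbabilityTheory.Kernel.sum_apply' _ _ h_s,
      ENNReal.tsum_prod (f := fun n k => κ (n, k) γ s)]
    have h1 : pointsKernel d γ s = ∑' n, pointsKernel d γ (s ∩ shell d n) := by
      conv_lhs => rw [← inter_univ s, ← iUnion_shell, inter_iUnion]
      refine measure_iUnion ?_ fun n => h_s.inter (measurableSet_shell n)
      exact fun m n hmn =>
        (pairwise_disjoint_shell hmn).mono inter_subset_right inter_subset_right
    rw [h1]
    refine tsum_congr fun n => ?_
    rw [tsum_eq_single (γ.count (shell d n))]
    · simp only [κ, ProbabilityTheory.Kernel.piecewise_apply]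
      rw [if_pos (by simp), ProbabilityTheory.Kernel.restrict_apply' _ _ _ h_s]
    · intro k hk
      simp only [κ, ProbabilityTheory.Kernel.piecewise_apply]
      rw [if_neg (by simpa using hk.symm)]
      simp
  rw [hsum]
  exact ProbabilityTheory.Kernel.isSFiniteKernel_sum

/-! ### Measurability of operations on configurations -/

section Measurability

variable {X : Type*} [MeasurableSpace X]

/-- Sums over the points of a measurable random configuration are measurable. -/
theorem measurable_lintegral_points {φ : X → Config d} (hφ : Measurable φ)
    {f : X → Point d → ℝ≥0∞} (hf : Measurable (Function.uncurry f)) :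
    Measurable fun x => ∫⁻ y, f x y ∂(φ x).points :=
  hf.lintegral_kernel_prod_right (κ := (pointsKernel d).comap φ hφ)

theorem measurable_restrict_section {φ : X → Config d} (hφ : Measurable φ)
    {S : X → Set (Point d)} (hS : MeasurableSet {p : X × Point d | p.2 ∈ S p.1}) :
    Measurable fun x => (φ x).restrict (S x) := by
  refine measurable_of_count fun Λ hb hm => ?_
  have h : ∀ x, ((φ x).restrict (S x)).points Λ =
      ∫⁻ y, (S x ∩ Λ).indicator 1 y ∂(φ x).points := by
    intro x
    have hSx : MeasurableSet (S x) := measurable_prodMk_left (x := x) hS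
    rw [lintegral_indicator_one (hSx.inter hm), points, points,
      Measure.restrict_apply hm, Measure.restrict_apply (hSx.inter hm)]
    congr 1
    change Λ ∩ ((φ x).carrier ∩ S x) = _
    ext y; simp only [mem_inter_iff]; tauto
  simp_rw [h]
  refine measurable_lintegral_points hφ ?_
  have : Function.uncurry (fun (x : X) (y : Point d) => (S x ∩ Λ).indicator (1 : Point d → ℝ≥0∞) y)
      = ({p : X × Point d | p.2 ∈ S p.1} ∩ Prod.snd ⁻¹' Λ).indicator 1 := by
    ext ⟨x, y⟩; simp only [Function.uncurry, indicator]; rfl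
  rw [this]
  exact measurable_one.indicator (hS.inter (measurable_snd hm))

theorem measurable_restrict {Λ : Set (Point d)} (hm : MeasurableSet Λ) :
    Measurable fun γ : Config d => γ.restrict Λ :=
  measurable_restrict_section measurable_id (measurable_snd hm)

theorem measurableSet_mem : MeasurableSet {p : Config d × Point d | p.2 ∈ p.1.carrier} := by
  have h : {p : Config d × Point d | p.2 ∈ p.1.carrier} =
      {p | ∫⁻ y, ({p.2} : Set (Point d)).indicator 1 y ∂p.1.points = 0}ᶜ := by
    ext ⟨γ, x⟩
    rw [mem_ofPred_eq, mem_compl_iff, mem_ofPred_eq,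
      lintegral_indicator_one (measurableSet_singleton x), points,
      Measure.restrict_apply (measurableSet_singleton x), Measure.count_eq_zero_iff,
      ← Ne, ← nonempty_iff_ne_empty, singleton_inter_nonempty]
  rw [h]
  refine (MeasurableSet.compl ?_)
  refine measurable_lintegral_points measurable_fst ?_ (measurableSet_singleton 0)
  have : Function.uncurry (fun (p : Config d × Point d) (y : Point d) =>
      ({p.2} : Set (Point d)).indicator (1 : Point d → ℝ≥0∞) y)
      = {q : (Config d × Point d) × Point d | q.2 = q.1.2}.indicator 1 := by
    ext ⟨p, y⟩; simp [Function.uncurry, indicator]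
  rw [this]
  exact measurable_one.indicator (measurableSet_eq_fun measurable_snd measurable_fst.snd)

theorem measurable_erase {φ : X → Config d} (hφ : Measurable φ) {u : X → Point d}
    (hu : Measurable u) : Measurable fun x => (φ x).erase (u x) := by
  have h : ∀ x, (φ x).erase (u x) = (φ x).restrict {u x}ᶜ := fun x => rfl
  simp_rw [h]
  refine measurable_restrict_section hφ ?_
  exact (measurableSet_eq_fun measurable_snd (hu.comp measurable_fst)).compl

theorem measurable_union {φ ψ : X → Config d} (hφ : Measurable φ) (hψ : Measurable ψ) :
    Measurable fun x => (φ x).union (ψ x) := by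
  refine measurable_of_count fun Λ hb hm => ?_
  have h : ∀ x, ((φ x).union (ψ x)).points Λ =
      (φ x).points Λ + ((ψ x).restrict (φ x).carrierᶜ).points Λ := by
    intro x
    simp only [points, Measure.restrict_apply hm]
    rw [← measure_union]
    · congr 1
      change Λ ∩ ((φ x).carrier ∪ (ψ x).carrier) =
        Λ ∩ (φ x).carrier ∪ Λ ∩ ((ψ x).carrier ∩ (φ x).carrierᶜ)
      ext y; simp only [mem_inter_iff, mem_union, mem_compl_iff]; tauto
    · refine Set.disjoint_left.2 fun y h1 h2 => h2.2.2 h1.2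
    · exact hm.inter (countable_carrier _).measurableSet
  simp_rw [h]
  have h2 := measurable_restrict_section (S := fun x => (φ x).carrierᶜ) hψ
    ((measurableSet_mem.preimage
      ((hφ.comp measurable_fst).prodMk measurable_snd)).compl)
  exact ((Measure.measurable_coe hm).comp (measurable_points.comp hφ)).add
    ((Measure.measurable_coe hm).comp (measurable_points.comp h2))

/-- The configuration `{x}`. -/
def single (x : Point d) : Config d := ofFinite {x} (finite_singleton x)

/-- The configuration `{x} ∪ γ`. -/
def add (x : Point d) (γ : Config d) : Config d := (single x).union γ

theorem measurable_single {u : X → Point d} (hu : Measurable u) :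
    Measurable fun x => single (u x) := by
  refine measurable_of_count fun Λ hb hm => ?_
  have h : ∀ x, (single (u x)).points Λ = Λ.indicator 1 (u x) := by
    intro x
    rw [← lintegral_indicator_one hm, lintegral_points_singleton _ rfl]
  simp_rw [h]
  exact (measurable_one.indicator hm).comp hu

theorem measurable_add {φ : X → Config d} (hφ : Measurable φ) {u : X → Point d}
    (hu : Measurable u) : Measurable fun x => add (u x) (φ x) :=
  measurable_union (measurable_single hu) hφ

/-- The configuration `{x_1, …, x_n}`. -/
def ofFn {n : ℕ} (x : Fin n → Point d) : Config d := ofFinite (range x) (finite_range x)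

theorem ofFn_succ {n : ℕ} (x : Fin (n + 1) → Point d) :
    ofFn x = add (x 0) (ofFn (Fin.tail x)) := by
  ext1
  change range x = insert (x 0) (range (Fin.tail x))
  rw [← Fin.range_cons, Fin.cons_self_tail]

theorem measurable_ofFn {n : ℕ} : Measurable (ofFn : (Fin n → Point d) → Config d) := by
  induction n with
  | zero => exact Subsingleton.measurable
  | succ n ih =>
    simp_rw [funext ofFn_succ]
    exact measurable_add (ih.comp (by fun_prop [Fin.tail])) (measurable_pi_apply 0)

/-- The configuration equal to the first one inside `Δ` and to the second one outside `Δ`. -/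
def splice (Δ : Set (Point d)) (γ' γ : Config d) : Config d :=
  (γ'.restrict Δ).union (γ.restrict Δᶜ)

theorem measurable_splice {Δ : Set (Point d)} (hm : MeasurableSet Δ) {φ ψ : X → Config d}
    (hφ : Measurable φ) (hψ : Measurable ψ) : Measurable fun x => splice Δ (φ x) (ψ x) :=
  measurable_union ((measurable_restrict hm).comp hφ) ((measurable_restrict hm.compl).comp hψ)

end Measurability

end Config

/-! ### The Poisson point process and the Mecke formula -/

namespace Config

variable {d : ℕ}

theorem lintegral_poissonLaw (Δ : Set (Point d)) {F : Config d → ℝ≥0∞} (hF : Measurable F) :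
    ∫⁻ γ, F γ ∂poissonLaw Δ = ∑' n : ℕ,
      (ENNReal.ofReal (Real.exp (-(volume Δ).toReal)) / (n.factorial : ℝ≥0∞)) *
        ∫⁻ x, F (ofFn x) ∂(Measure.pi fun _ : Fin n => (volume : Measure (Point d)).restrict Δ) := by
  rw [poissonLaw, lintegral_sum_measure]
  refine tsum_congr fun n => ?_
  rw [lintegral_smul_measure, smul_eq_mul]
  congr 1
  exact lintegral_map hF measurable_ofFn

theorem ae_poissonLaw_subset {Δ : Set (Point d)} (hb : Bornology.IsBounded Δ)
    (hm : MeasurableSet Δ) : ∀ᵐ γ ∂poissonLaw Δ, γ.carrier ⊆ Δ := by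
  have hfin : IsFiniteMeasure ((volume : Measure (Point d)).restrict Δ) :=
    ⟨by rw [Measure.restrict_apply_univ]; exact hb.measure_lt_top⟩
  rw [poissonLaw, Measure.ae_sum_iff]
  intro n
  refine Measure.ae_smul_measure ?_ _
  have hS : MeasurableSet {γ : Config d | γ.carrier ⊆ Δ} := by
    have : {γ : Config d | γ.carrier ⊆ Δ} = {γ | γ.points Δᶜ = 0} := by
      ext γ
      rw [mem_ofPred_eq, mem_ofPred_eq, points, Measure.restrict_apply hm.compl,
        Measure.count_eq_zero_iff, inter_comm, ← sdiff_eq, sdiff_eq_empty]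
    rw [this]
    exact (Measure.measurable_coe hm.compl).comp measurable_points (measurableSet_singleton 0)
  refine (ae_map_iff (p := fun γ : Config d => γ.carrier ⊆ Δ)
    (measurable_ofFn (n := n)).aemeasurable hS).2 ?_
  have h : ∀ᵐ x ∂(Measure.pi fun _ : Fin n => (volume : Measure (Point d)).restrict Δ),
      ∀ i, x i ∈ Δ := by
    rw [ae_all_iff]
    intro i
    exact Measure.tendsto_eval_ae_ae.eventually (ae_restrict_mem hm)
  filter_upwards [h] with x hx
  exact range_subset_iff.2 hx

/-- The Poisson point process charges the empty configuration with mass `e^{-|Δ|}`. -/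
theorem lintegral_poissonLaw_count_zero {Δ : Set (Point d)} (hb : Bornology.IsBounded Δ)
    (hm : MeasurableSet Δ) {F : Config d → ℝ≥0∞} (hF : Measurable F) :
    ∫⁻ γ, {γ | count Δ γ = 0}.indicator F γ ∂poissonLaw Δ =
      ENNReal.ofReal (Real.exp (-(volume Δ).toReal)) * F (ofFinite ∅ finite_empty) := by
  have hfin : IsFiniteMeasure ((volume : Measure (Point d)).restrict Δ) :=
    ⟨by rw [Measure.restrict_apply_univ]; exact hb.measure_lt_top⟩
  have hS : MeasurableSet {γ : Config d | count Δ γ = 0} :=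
    measurable_count hb hm (measurableSet_singleton 0)
  rw [lintegral_poissonLaw Δ (hF.indicator hS), tsum_eq_single 0]
  · have h : ∀ x : Fin 0 → Point d, ofFn x = ofFinite ∅ finite_empty := by
      intro x
      ext1
      exact range_eq_empty x
    simp_rw [h]
    simp [count, ofFinite]
  · intro n hn
    obtain ⟨n, rfl⟩ := Nat.exists_eq_succ_of_ne_zero hn
    refine mul_eq_zero_of_right _ ?_
    refine (lintegral_eq_zero_iff ((hF.indicator hS).comp measurable_ofFn)).2 ?_
    have h : ∀ᵐ x ∂(Measure.pi fun _ : Fin (n + 1) => (volume : Measure (Point d)).restrict Δ),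
        x 0 ∈ Δ := Measure.tendsto_eval_ae_ae.eventually (ae_restrict_mem hm)
    filter_upwards [h] with x hx
    refine indicator_of_notMem (fun h0 => ?_) _
    rw [mem_ofPred_eq, count, Set.ncard_eq_zero ((ofFn x).finite_inter Δ hb)] at h0
    exact (h0 ▸ (⟨⟨0, rfl⟩, hx⟩ : x 0 ∈ (ofFn x).carrier ∩ Δ) : x 0 ∈ (∅ : Set (Point d)))

theorem ae_injective_pi (μ : Measure (Point d)) [IsFiniteMeasure μ] [NullSingletonClass μ] (n : ℕ) :
    ∀ᵐ x ∂(Measure.pi fun _ : Fin n => μ), Function.Injective x := by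
  cases n with
  | zero => exact Filter.Eventually.of_forall fun x => Function.injective_of_subsingleton x
  | succ n =>
    have h : ∀ (i : Fin (n + 1)) (k : Fin n),
        ∀ᵐ x ∂(Measure.pi fun _ : Fin (n + 1) => μ), x i ≠ x (i.succAbove k) := by
      intro i k
      have hmp := measurePreserving_piFinSuccAbove (fun _ : Fin (n + 1) => μ) i
      have hp : ∀ᵐ p ∂(μ.prod (Measure.pi fun _ : Fin n => μ)), p.1 ≠ p.2 k := by
        have hS : MeasurableSet {p : Point d × (Fin n → Point d) | p.1 ≠ p.2 k} :=
          (measurableSet_eq_fun (g := fun p : Point d × (Fin n → Point d) => p.2 k)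
            measurable_fst ((measurable_pi_apply k).comp measurable_snd)).compl
        rw [Measure.ae_prod_iff_ae_ae hS, Measure.ae_ae_comm hS]
        exact Filter.Eventually.of_forall fun y =>
          compl_mem_ae_iff.2 (measure_singleton (y k))
      exact hmp.quasiMeasurePreserving.ae hp
    simp_rw [← ae_all_iff] at h
    filter_upwards [h] with x hx i j hij
    by_contra hne
    obtain ⟨k, hk⟩ := Fin.exists_succAbove_eq (Ne.symm hne)
    exact hx i k (hk ▸ hij)

theorem lintegral_points_ofFn {n : ℕ} {x : Fin n → Point d} (hx : Function.Injective x)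
    (f : Point d → ℝ≥0∞) : ∫⁻ u, f u ∂(ofFn x).points = ∑ i, f (x i) := by
  rw [lintegral_points, ← tsum_fintype (L := .unconditional _)]
  exact tsum_range f hx

theorem erase_ofFn {n : ℕ} {x : Fin (n + 1) → Point d} (hx : Function.Injective x)
    (i : Fin (n + 1)) : (ofFn x).erase (x i) = ofFn (i.removeNth x) := by
  ext1
  change range x \ {x i} = range (x ∘ i.succAbove)
  rw [range_comp, Fin.range_succAbove, image_compl_eq_range_sdiff_image hx, image_singleton]

theorem lintegral_pi_succAbove (μ : Measure (Point d)) [IsFiniteMeasure μ]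
    {g : Point d → Config d → ℝ≥0∞} (hg : Measurable (Function.uncurry g)) {n : ℕ}
    (i : Fin (n + 1)) :
    ∫⁻ x, g (x i) (ofFn (i.removeNth x)) ∂(Measure.pi fun _ : Fin (n + 1) => μ) =
      ∫⁻ x, ∫⁻ u, g u (ofFn x) ∂μ ∂(Measure.pi fun _ : Fin n => μ) := by
  have hmp := measurePreserving_piFinSuccAbove (fun _ : Fin (n + 1) => μ) i
  have hm2 : Measurable fun p : Point d × (Fin n → Point d) => g p.1 (ofFn p.2) :=
    hg.comp (measurable_fst.prodMk (measurable_ofFn.comp measurable_snd))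
  have h := hmp.lintegral_comp hm2
  rw [lintegral_prod_symm' _ hm2] at h
  exact h

theorem lintegral_pi_mecke (μ : Measure (Point d)) [IsFiniteMeasure μ] [NullSingletonClass μ]
    {g : Point d → Config d → ℝ≥0∞} (hg : Measurable (Function.uncurry g)) {n : ℕ} :
    ∫⁻ x, ∫⁻ u, g u ((ofFn x).erase u) ∂(ofFn x).points ∂(Measure.pi fun _ : Fin (n + 1) => μ) =
      (n + 1 : ℕ) * ∫⁻ x, ∫⁻ u, g u (ofFn x) ∂μ ∂(Measure.pi fun _ : Fin n => μ) := by
  have hmi : ∀ i : Fin (n + 1),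
      Measurable fun x : Fin (n + 1) → Point d => g (x i) (ofFn (i.removeNth x)) := by
    intro i
    have h : Measurable fun x : Fin (n + 1) → Point d => ofFn (i.removeNth x) :=
      measurable_ofFn.comp
        (measurable_pi_lambda _ fun k => measurable_pi_apply (i.succAbove k))
    exact hg.comp ((measurable_pi_apply i).prodMk h)
  have hi := fun i => lintegral_pi_succAbove μ hg (n := n) i
  calc _ = ∫⁻ x, ∑ i, g (x i) (ofFn (i.removeNth x)) ∂(Measure.pi fun _ : Fin (n + 1) => μ) := by
        refine lintegral_congr_ae ?_
        filter_upwards [ae_injective_pi μ (n + 1)] with x hx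
        rw [lintegral_points_ofFn hx]
        simp_rw [erase_ofFn hx]
    _ = _ := by
        rw [lintegral_finsetSum _ fun i _ => hmi i]
        simp_rw [hi]
        simp

theorem _root_.ENNReal.tsum_eq_tsum_of_zero_of_succ {f g : ℕ → ℝ≥0∞} (h0 : f 0 = 0)
    (h : ∀ n, f (n + 1) = g n) : ∑' n, f n = ∑' n, g n := by
  rw [tsum_eq_zero_add' ENNReal.summable, h0, zero_add]
  exact tsum_congr h

/-- The Mecke formula for the Poisson point process of unit intensity in `Δ`. -/
theorem lintegral_poissonLaw_mecke (hd : 0 < d) {Δ : Set (Point d)} (hb : Bornology.IsBounded Δ)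
    {g : Point d → Config d → ℝ≥0∞} (hg : Measurable (Function.uncurry g)) :
    ∫⁻ γ, ∫⁻ x, g x (γ.erase x) ∂γ.points ∂poissonLaw Δ =
      ∫⁻ γ, (∫⁻ x in Δ, g x γ) ∂poissonLaw Δ := by
  have : Nonempty (Fin d) := ⟨⟨0, hd⟩⟩
  set μ := (volume : Measure (Point d)).restrict Δ with hμ
  have hfin : IsFiniteMeasure μ :=
    ⟨by rw [Measure.restrict_apply_univ]; exact hb.measure_lt_top⟩
  have hmL : Measurable fun γ : Config d => ∫⁻ x, g x (γ.erase x) ∂γ.points :=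
    measurable_lintegral_points measurable_id
      (hg.comp (measurable_snd.prodMk (measurable_erase measurable_fst measurable_snd)))
  have hmR : Measurable fun γ : Config d => ∫⁻ x, g x γ ∂μ :=
    (hg.comp measurable_swap).lintegral_prod_right'
  rw [lintegral_poissonLaw Δ hmL, lintegral_poissonLaw Δ hmR, ← hμ]
  have h0 : ∀ x : Fin 0 → Point d,
      ∫⁻ u, g u ((ofFn x).erase u) ∂(ofFn x).points = 0 := fun x => by
    rw [lintegral_points_ofFn (Function.injective_of_subsingleton x)]; simp
  refine ENNReal.tsum_eq_tsum_of_zero_of_succ (by simp_rw [h0, lintegral_zero, mul_zero]) fun n => ?_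
  rw [lintegral_pi_mecke μ hg, ← mul_assoc]
  congr 1
  rw [Nat.factorial_succ, Nat.cast_mul, div_eq_mul_inv, div_eq_mul_inv,
    ENNReal.mul_inv (Or.inl (by simp)) (Or.inl (by simp)), mul_assoc]
  congr 1
  rw [mul_right_comm, ENNReal.inv_mul_cancel (by simp) (by simp), one_mul]

end Config

/-! ### Boltzmann factors -/

section Boltzmann

theorem boltzmann_beta_zero (u : EReal) : boltzmann 0 u = 1 := by simp [boltzmann]

theorem boltzmann_zero (β : ℝ) : boltzmann β 0 = 1 := by simp [boltzmann]

theorem boltzmann_top {β : ℝ} (hβ : 0 < β) : boltzmann β ⊤ = 0 := by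
  rw [boltzmann, EReal.coe_mul_top_of_pos hβ]; simp

theorem boltzmann_coe (β u : ℝ) : boltzmann β u = ENNReal.ofReal (Real.exp (-(β * u))) := by
  rw [boltzmann, ← EReal.coe_mul, ← EReal.coe_neg, EReal.exp_coe]

theorem energySub_self (a : EReal) (ha : a ≠ ⊥) : energySub a a = 0 := by
  rw [energySub]
  split_ifs with h
  · rfl
  · exact EReal.sub_self (fun h' => h ⟨h', h'⟩) ha

theorem energySub_coe (a : EReal) (b : ℝ) : energySub a b = a - b := by
  rw [energySub, if_neg]
  rintro ⟨-, h⟩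
  exact EReal.coe_ne_top b h

theorem energySub_ne_bot {a b : EReal} (ha : a ≠ ⊥) (h : b = ⊤ → a = ⊤) :
    energySub a b ≠ ⊥ := by
  rw [energySub]
  split_ifs with h'
  · simp
  · have hb : b ≠ ⊤ := fun hb => h' ⟨h hb, hb⟩
    rw [sub_eq_add_neg]
    rw [Ne, EReal.add_eq_bot_iff, not_or]
    exact ⟨ha, by simpa using hb⟩

theorem boltzmann_ne_top {β : ℝ} (hβ : 0 ≤ β) {u : EReal} (hu : u ≠ ⊥) :
    boltzmann β u ≠ ⊤ := by
  induction u with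
  | bot => exact absurd rfl hu
  | coe u => rw [boltzmann_coe]; exact ENNReal.ofReal_ne_top
  | top =>
    rcases hβ.eq_or_lt with rfl | h
    · simp [boltzmann_beta_zero]
    · simp [boltzmann_top h]

theorem boltzmann_eq_zero {β : ℝ} (hβ : 0 ≤ β) {u : EReal} (hu : boltzmann β u = 0) :
    0 < β ∧ u = ⊤ := by
  rcases hβ.eq_or_lt with rfl | h
  · simp [boltzmann_beta_zero] at hu
  refine ⟨h, ?_⟩
  induction u with
  | bot =>
    rw [boltzmann, EReal.coe_mul_bot_of_pos h] at hu
    simp at hu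
  | coe u =>
    rw [boltzmann_coe, ENNReal.ofReal_eq_zero] at hu
    exact absurd hu (not_le.2 (Real.exp_pos _))
  | top => rfl

/-- Energy increments add up, and Boltzmann factors multiply, as long as the energy subtracted last
is finite. -/
theorem boltzmann_energySub_mul {β : ℝ} (hβ : 0 < β) {a g c : EReal} (ha : a ≠ ⊥) (hg : g ≠ ⊥)
    (hc : c ≠ ⊥) (hc' : c ≠ ⊤) (hag : g = ⊤ → a = ⊤) :
    boltzmann β (energySub a c) = boltzmann β (energySub g c) * boltzmann β (energySub a g) := by
  lift c to ℝ using ⟨hc', hc⟩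
  by_cases hgt : g = ⊤
  · rw [hag hgt, hgt, energySub_coe, EReal.top_sub_coe, boltzmann_top hβ, zero_mul]
  lift g to ℝ using ⟨hgt, hg⟩
  rw [energySub_coe, energySub_coe, energySub_coe]
  by_cases hat : a = ⊤
  · rw [hat, EReal.top_sub_coe, EReal.top_sub_coe, boltzmann_top hβ, mul_zero]
  lift a to ℝ using ⟨hat, ha⟩
  rw [← EReal.coe_sub, ← EReal.coe_sub, ← EReal.coe_sub, boltzmann_coe, boltzmann_coe,
    boltzmann_coe, ← ENNReal.ofReal_mul (Real.exp_pos _).le, ← Real.exp_add]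
  congr 2
  ring

theorem measurable_energySub : Measurable fun p : EReal × EReal => energySub p.1 p.2 := by
  unfold energySub
  refine Measurable.ite ?_ measurable_const ?_
  · exact (measurable_fst (measurableSet_singleton ⊤)).inter
      (measurable_snd (measurableSet_singleton ⊤))
  · exact measurable_fst.sub measurable_snd

theorem measurable_boltzmann (β : ℝ) : Measurable (boltzmann β) := by
  unfold boltzmann
  exact EReal.measurable_exp.comp (measurable_const.mul measurable_id).neg

end Boltzmann

/-! ### Energies of finite configurations and of windows -/

section Energy

variable {d : ℕ} {H : FinConfig d → EReal}

theorem FinConfig.ext_carrier {γ γ' : FinConfig d} (h : γ.1.carrier = γ'.1.carrier) : γ = γ' :=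
  Subtype.ext (Config.ext h)

/-- Finiteness of the energy passes from a finite configuration to all its subsets. -/
theorem IsEnergyFunction.ne_top_of_subset (hH : IsEnergyFunction H) {γ γ' : FinConfig d}
    (h : γ'.1.carrier ⊆ γ.1.carrier) (hγ : H γ ≠ ⊤) : H γ' ≠ ⊤ := by
  obtain ⟨n, hn⟩ : ∃ n, (γ.1.carrier \ γ'.1.carrier).ncard = n := ⟨_, rfl⟩
  induction n generalizing γ with
  | zero =>
    rw [Set.ncard_eq_zero (γ.2.subset sdiff_subset), sdiff_eq_empty] at hn
    rwa [FinConfig.ext_carrier (h.antisymm hn)]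
  | succ n ih =>
    have hne : (γ.1.carrier \ γ'.1.carrier).Nonempty := by
      rw [← Set.ncard_pos (γ.2.subset sdiff_subset)]; omega
    obtain ⟨x, hx⟩ := hne
    refine ih (γ := γ.erase x) (fun y hy => ⟨h hy, ?_⟩) (hH.hereditary γ x hx.1 hγ) ?_
    · rintro rfl; exact hx.2 hy
    · have : (γ.erase x).1.carrier \ γ'.1.carrier = (γ.1.carrier \ γ'.1.carrier) \ {x} := by
        change (γ.1.carrier \ {x}) \ γ'.1.carrier = _
        ext y; simp only [mem_sdiff, mem_singleton_iff]; tauto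
      rw [this, Set.ncard_sdiff_singleton_of_mem hx, hn]
      rfl

theorem deltaEnergyFin_ne_bot (hH : IsEnergyFunction H) (Δ : Set (Point d)) (γ : FinConfig d) :
    deltaEnergyFin H Δ γ ≠ ⊥ := by
  refine energySub_ne_bot (hH.ne_bot _) fun h => ?_
  by_contra hγ
  exact hH.ne_top_of_subset (γ' := γ.restrict Δᶜ) inter_subset_left hγ h

theorem restrictBounded_add {Λ : Set (Point d)} (hΛ : Bornology.IsBounded Λ) {x : Point d}
    (hx : x ∈ Λ) (γ : Config d) :
    (Config.add x γ).restrictBounded Λ hΛ = FinConfig.insert x (γ.restrictBounded Λ hΛ) := by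
  refine FinConfig.ext_carrier ?_
  change insert x γ.carrier ∩ Λ = insert x (γ.carrier ∩ Λ)
  rw [insert_inter_of_mem hx]

theorem erase_insert {x : Point d} {G : FinConfig d} (hx : x ∉ G.1.carrier) :
    (FinConfig.insert x G).erase x = G := by
  refine FinConfig.ext_carrier ?_
  change insert x G.1.carrier \ {x} = _
  exact insert_sdiff_self_of_notMem hx

theorem insert_eq_top (hH : IsEnergyFunction H) {x : Point d} {G : FinConfig d}
    (hx : x ∉ G.1.carrier) (hG : H G = ⊤) : H (FinConfig.insert x G) = ⊤ := by
  by_contra h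
  have h1 := hH.hereditary _ x (show x ∈ insert x G.1.carrier from mem_insert _ _) h
  rw [erase_insert hx] at h1
  exact h1 hG

/-- By the finite range property for `{x}`, the local energy can be computed in any window that
contains the ball `B(x, R)` and has finite energy. -/
theorem localEnergy_eq {R : ℝ} (hrange : HasFiniteRange H R)
    {Λ : Set (Point d)} (hΛ : Bornology.IsBounded Λ) {x : Point d}
    (hxΛ : Metric.closedBall x R ⊆ Λ) (hR : 0 < R) {γ : Config d} (hxγ : x ∉ γ.carrier)
    (hfin : H (γ.restrictBounded Λ hΛ) ≠ ⊤) :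
    localEnergy H R x γ = energySub (H (FinConfig.insert x (γ.restrictBounded Λ hΛ)))
      (H (γ.restrictBounded Λ hΛ)) := by
  have h1 : ∀ G : FinConfig d, x ∉ G.1.carrier → (FinConfig.insert x G).restrict {x}ᶜ = G :=
    fun G hG => erase_insert hG
  have hxG : x ∉ (γ.restrictBounded Λ hΛ).1.carrier := fun h => hxγ h.1
  have hxG' : x ∉ (γ.restrictBounded (Metric.closedBall x R) Metric.isBounded_closedBall).1.carrier :=
    fun h => hxγ h.1
  have h2 : (FinConfig.insert x (γ.restrictBounded Λ hΛ)).restrict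
      ({x} + Metric.closedBall 0 R) = FinConfig.insert x
        (γ.restrictBounded (Metric.closedBall x R) Metric.isBounded_closedBall) := by
    refine FinConfig.ext_carrier ?_
    rw [singleton_add_closedBall, add_zero]
    change insert x (γ.carrier ∩ Λ) ∩ Metric.closedBall x R =
      insert x (γ.carrier ∩ Metric.closedBall x R)
    rw [insert_inter_of_mem (Metric.mem_closedBall_self hR.le), inter_assoc,
      inter_eq_right.2 hxΛ]
  have h := hrange {x} Bornology.isBounded_singleton (FinConfig.insert x (γ.restrictBounded Λ hΛ))
    (by rwa [h1 _ hxG])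
  rw [h2, deltaEnergyFin, deltaEnergyFin, h1 _ hxG, h1 _ hxG'] at h
  exact h.symm

/-- The Boltzmann factor of `Δ`, with the energy computed in the window `Λ`. -/
noncomputable def windowBoltzmann (H : FinConfig d → EReal) (β : ℝ) (Δ Λ : Set (Point d))
    (hΛ : Bornology.IsBounded Λ) (γ : Config d) : ℝ≥0∞ :=
  boltzmann β (deltaEnergyFin H Δ (γ.restrictBounded Λ hΛ))

/-- The density `z^{N_Δ} e^{-β H_Δ}`, with the energy computed in the window `Λ`. -/
noncomputable def windowWeight (H : FinConfig d → EReal) (z β : ℝ) (Δ Λ : Set (Point d))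
    (hΛ : Bornology.IsBounded Λ) (γ : Config d) : ℝ≥0∞ :=
  ENNReal.ofReal z ^ γ.count Δ * windowBoltzmann H β Δ Λ hΛ γ

/-- At a configuration admissible for `(Δ, Λ)`, no convention `∞ - ∞` enters the energy of `Δ` in
the window `Λ`. For `β = 0` the energy plays no role. -/
def Admissible (H : FinConfig d → EReal) (β : ℝ) (Δ Λ : Set (Point d))
    (hΛ : Bornology.IsBounded Λ) (γ : Config d) : Prop :=
  0 < β → H ((γ.restrictBounded Λ hΛ).restrict Δᶜ) ≠ ⊤

theorem restrict_compl_splice (Δ : Set (Point d)) (γ' γ : Config d) :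
    (Config.splice Δ γ' γ).restrict Δᶜ = γ.restrict Δᶜ := by
  ext1
  change (γ'.carrier ∩ Δ ∪ γ.carrier ∩ Δᶜ) ∩ Δᶜ = γ.carrier ∩ Δᶜ
  ext y; simp only [mem_inter_iff, mem_union, mem_compl_iff]; tauto

theorem restrict_splice (Δ : Set (Point d)) (γ' γ : Config d) :
    (Config.splice Δ γ' γ).restrict Δ = γ'.restrict Δ := by
  ext1
  change (γ'.carrier ∩ Δ ∪ γ.carrier ∩ Δᶜ) ∩ Δ = γ'.carrier ∩ Δ
  ext y; simp only [mem_inter_iff, mem_union, mem_compl_iff]; tauto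

theorem count_splice (Δ : Set (Point d)) (γ' γ : Config d) :
    (Config.splice Δ γ' γ).count Δ = γ'.count Δ := by
  change ((Config.splice Δ γ' γ).restrict Δ).carrier.ncard = _
  rw [restrict_splice]; rfl

/-- Admissibility depends on the configuration outside `Δ` only. -/
theorem Admissible.congr {β : ℝ} {Δ Λ : Set (Point d)} {hΛ : Bornology.IsBounded Λ}
    {γ γ' : Config d} (h : Admissible H β Δ Λ hΛ γ) (hγ : γ'.restrict Δᶜ = γ.restrict Δᶜ) :
    Admissible H β Δ Λ hΛ γ' := by
  intro hβ
  have : (γ'.restrictBounded Λ hΛ).restrict Δᶜ = (γ.restrictBounded Λ hΛ).restrict Δᶜ := by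
    refine FinConfig.ext_carrier ?_
    have h' : γ'.carrier ∩ Δᶜ = γ.carrier ∩ Δᶜ := congrArg Config.carrier hγ
    change γ'.carrier ∩ Λ ∩ Δᶜ = γ.carrier ∩ Λ ∩ Δᶜ
    rw [inter_right_comm, h', inter_right_comm]
  rw [this]
  exact h hβ

theorem Config.count_add {Δ : Set (Point d)} (hΔ : Bornology.IsBounded Δ) {x : Point d}
    (hx : x ∈ Δ) {γ : Config d} (hxγ : x ∉ γ.carrier) :
    (Config.add x γ).count Δ = γ.count Δ + 1 := by
  change (insert x γ.carrier ∩ Δ).ncard = (γ.carrier ∩ Δ).ncard + 1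
  rw [insert_inter_of_mem hx,
    Set.ncard_insert_of_notMem (fun h => hxγ h.1) (γ.finite_inter Δ hΔ)]

variable {R z β : ℝ} {Δ Λ : Set (Point d)} {hΛ : Bornology.IsBounded Λ}

theorem restrictBounded_add_restrict_compl {x : Point d} (hx : x ∈ Δ) (γ : Config d) :
    ((Config.add x γ).restrictBounded Λ hΛ).restrict Δᶜ =
      (γ.restrictBounded Λ hΛ).restrict Δᶜ := by
  refine FinConfig.ext_carrier ?_
  change insert x γ.carrier ∩ Λ ∩ Δᶜ = γ.carrier ∩ Λ ∩ Δᶜ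
  ext y
  simp only [mem_inter_iff, mem_insert_iff, mem_compl_iff]
  constructor
  · rintro ⟨⟨rfl | h, h1⟩, h2⟩
    · exact absurd hx h2
    · exact ⟨⟨h, h1⟩, h2⟩
  · rintro ⟨⟨h, h1⟩, h2⟩
    exact ⟨⟨Or.inr h, h1⟩, h2⟩

/-- Adding a point `x ∈ Δ` to an admissible configuration multiplies the Boltzmann factor of `Δ` by
the Boltzmann factor of the local energy of `x`. -/
theorem windowBoltzmann_add (hH : IsEnergyFunction H) (hR : 0 < R) (hrange : HasFiniteRange H R)
    (hβ : 0 ≤ β) (hΔΛ : Δ + Metric.closedBall 0 R ⊆ Λ) {x : Point d} (hx : x ∈ Δ)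
    {γ : Config d} (hxγ : x ∉ γ.carrier) (hadm : Admissible H β Δ Λ hΛ γ) :
    windowBoltzmann H β Δ Λ hΛ (Config.add x γ) =
      windowBoltzmann H β Δ Λ hΛ γ * boltzmann β (localEnergy H R x γ) := by
  rcases hβ.eq_or_lt with rfl | hβ
  · simp [windowBoltzmann, boltzmann_beta_zero]
  have hball : Metric.closedBall x R ⊆ Λ := by
    have h : {x} + Metric.closedBall (0 : Point d) R = Metric.closedBall x R := by
      rw [singleton_add_closedBall, add_zero]
    rw [← h]
    refine Subset.trans ?_ hΔΛ
    exact add_subset_add_right (singleton_subset_iff.2 hx)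
  have hxΛ : x ∈ Λ := hball (Metric.mem_closedBall_self hR.le)
  have hxG : x ∉ (γ.restrictBounded Λ hΛ).1.carrier := fun h => hxγ h.1
  rw [windowBoltzmann, windowBoltzmann, deltaEnergyFin, deltaEnergyFin,
    restrictBounded_add_restrict_compl hx, restrictBounded_add hΛ hxΛ]
  have hc := hadm hβ
  by_cases hG : H (γ.restrictBounded Λ hΛ) = ⊤
  · rw [insert_eq_top hH hxG hG, hG]
    have : boltzmann β (energySub ⊤ (H ((γ.restrictBounded Λ hΛ).restrict Δᶜ))) = 0 := by
      lift H ((γ.restrictBounded Λ hΛ).restrict Δᶜ) to ℝ using ⟨hc, hH.ne_bot _⟩ with c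
      rw [energySub_coe, EReal.top_sub_coe, boltzmann_top hβ]
    rw [this, zero_mul]
  · rw [localEnergy_eq hrange hΛ hball hR hxγ hG]
    exact boltzmann_energySub_mul hβ (hH.ne_bot _) (hH.ne_bot _) (hH.ne_bot _) hc
      (fun h => insert_eq_top hH hxG h)

theorem windowWeight_add (hH : IsEnergyFunction H) (hR : 0 < R) (hrange : HasFiniteRange H R)
    (hβ : 0 ≤ β) (hΔ : Bornology.IsBounded Δ) (hΔΛ : Δ + Metric.closedBall 0 R ⊆ Λ)
    {x : Point d} (hx : x ∈ Δ) {γ : Config d} (hxγ : x ∉ γ.carrier)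
    (hadm : Admissible H β Δ Λ hΛ γ) :
    windowWeight H z β Δ Λ hΛ (Config.add x γ) =
      windowWeight H z β Δ Λ hΛ γ * (ENNReal.ofReal z * boltzmann β (localEnergy H R x γ)) := by
  rw [windowWeight, windowWeight, windowBoltzmann_add hH hR hrange hβ hΔΛ hx hxγ hadm,
    Config.count_add hΔ hx hxγ, pow_succ]
  ring

theorem windowBoltzmann_ne_top (hH : IsEnergyFunction H) (hβ : 0 ≤ β) (γ : Config d) :
    windowBoltzmann H β Δ Λ hΛ γ ≠ ⊤ :=
  boltzmann_ne_top hβ (deltaEnergyFin_ne_bot hH _ _)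

theorem windowWeight_ne_top (hH : IsEnergyFunction H) (hβ : 0 ≤ β) (γ : Config d) :
    windowWeight H z β Δ Λ hΛ γ ≠ ⊤ :=
  ENNReal.mul_ne_top (ENNReal.pow_ne_top ENNReal.ofReal_ne_top) (windowBoltzmann_ne_top hH hβ γ)

/-- Configurations of weight zero keep weight zero when points are added. -/
theorem windowWeight_add_eq_zero (hH : IsEnergyFunction H) (hz : 0 < z) (hβ : 0 ≤ β)
    (hΔΛ : Δ ⊆ Λ) {x : Point d} (hx : x ∈ Δ) {γ : Config d} (hxγ : x ∉ γ.carrier)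
    (h0 : windowWeight H z β Δ Λ hΛ γ = 0) :
    windowWeight H z β Δ Λ hΛ (Config.add x γ) = 0 := by
  rw [windowWeight, mul_eq_zero] at h0
  have h1 := h0.resolve_left (pow_ne_zero _ (ENNReal.ofReal_pos.2 hz).ne')
  obtain ⟨hβ', h2⟩ := boltzmann_eq_zero hβ h1
  refine mul_eq_zero_of_right _ ?_
  have hxG : x ∉ (γ.restrictBounded Λ hΛ).1.carrier := fun h => hxγ h.1
  rw [windowBoltzmann, deltaEnergyFin, restrictBounded_add_restrict_compl hx,
    restrictBounded_add hΛ (hΔΛ hx)]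
  rw [deltaEnergyFin] at h2
  have hc : H ((γ.restrictBounded Λ hΛ).restrict Δᶜ) ≠ ⊤ := by
    intro hc
    have hG : H (γ.restrictBounded Λ hΛ) = ⊤ := by
      by_contra hG
      exact hH.ne_top_of_subset (γ' := (γ.restrictBounded Λ hΛ).restrict Δᶜ)
        inter_subset_left hG hc
    rw [hc, hG, energySub_self _ (by simp)] at h2
    exact EReal.zero_ne_top h2
  have hG : H (γ.restrictBounded Λ hΛ) = ⊤ := by
    by_contra hG
    lift H ((γ.restrictBounded Λ hΛ).restrict Δᶜ) to ℝ using ⟨hc, hH.ne_bot _⟩ with c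
    lift H (γ.restrictBounded Λ hΛ) to ℝ using ⟨hG, hH.ne_bot _⟩ with g
    rw [energySub_coe, ← EReal.coe_sub] at h2
    exact EReal.coe_ne_top _ h2
  rw [insert_eq_top hH hxG hG]
  lift H ((γ.restrictBounded Λ hΛ).restrict Δᶜ) to ℝ using ⟨hc, hH.ne_bot _⟩ with c
  rw [energySub_coe, EReal.top_sub_coe, boltzmann_top hβ']

/-- At configurations that are admissible for a large window, the energy of `Δ` can be computed in
that window. -/
theorem windowBoltzmann_eq (hrange : HasFiniteRange H R) (hβ : 0 ≤ β)
    (hΔ : Bornology.IsBounded Δ) (hΔΛ : Δ + Metric.closedBall 0 R ⊆ Λ) {γ : Config d}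
    (hadm : Admissible H β Δ Λ hΛ γ) :
    boltzmann β (deltaEnergy H R Δ hΔ γ) = windowBoltzmann H β Δ Λ hΛ γ := by
  rcases hβ.eq_or_lt with rfl | hβ
  · simp [windowBoltzmann, boltzmann_beta_zero]
  have h := hrange Δ hΔ (γ.restrictBounded Λ hΛ) (hadm hβ)
  have h2 : (γ.restrictBounded Λ hΛ).restrict (Δ + Metric.closedBall 0 R) =
      γ.restrictBounded (Δ + Metric.closedBall 0 R) (hΔ.add Metric.isBounded_closedBall) := by
    refine FinConfig.ext_carrier ?_
    change γ.carrier ∩ Λ ∩ _ = γ.carrier ∩ _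
    rw [inter_assoc, inter_eq_right.2 hΔΛ]
  rw [windowBoltzmann, h, h2, deltaEnergy]

theorem gibbsWeight_eq_windowWeight (hΔ : Bornology.IsBounded Δ) {γ γ' : Config d}
    (h : boltzmann β (deltaEnergy H R Δ hΔ (Config.splice Δ γ' γ)) =
      windowBoltzmann H β Δ Λ hΛ (Config.splice Δ γ' γ)) :
    gibbsWeight H R z β Δ hΔ γ γ' = windowWeight H z β Δ Λ hΛ (Config.splice Δ γ' γ) := by
  rw [windowWeight, count_splice, ← h]
  rfl

theorem windowBoltzmann_restrict_compl (hH : IsEnergyFunction H) (γ : Config d) :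
    windowBoltzmann H β Δ Λ hΛ (γ.restrict Δᶜ) = 1 := by
  have h : ((γ.restrict Δᶜ).restrictBounded Λ hΛ).restrict Δᶜ =
      (γ.restrict Δᶜ).restrictBounded Λ hΛ := by
    refine FinConfig.ext_carrier ?_
    change γ.carrier ∩ Δᶜ ∩ Λ ∩ Δᶜ = γ.carrier ∩ Δᶜ ∩ Λ
    ext y; simp only [mem_inter_iff, mem_compl_iff]; tauto
  rw [windowBoltzmann, deltaEnergyFin, h, energySub_self _ (hH.ne_bot _), boltzmann_zero]

theorem measurable_restrictBounded_section {X : Type*} [MeasurableSpace X] {φ : X → Config d}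
    (hφ : Measurable φ) {S : X → Set (Point d)} (hS : ∀ x, Bornology.IsBounded (S x))
    (hm : MeasurableSet {p : X × Point d | p.2 ∈ S p.1}) :
    Measurable fun x => (φ x).restrictBounded (S x) (hS x) :=
  (Config.measurable_restrict_section hφ hm).subtype_mk

theorem measurable_windowBoltzmann (hH : IsEnergyFunction H) (hΔm : MeasurableSet Δ)
    (hΛm : MeasurableSet Λ) : Measurable (windowBoltzmann H β Δ Λ hΛ) := by
  refine (measurable_boltzmann β).comp (measurable_energySub.comp ((hH.measurable.comp ?_).prodMk
    (hH.measurable.comp ?_)))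
  · exact (Config.measurable_restrict hΛm).subtype_mk
  · exact ((Config.measurable_restrict hΔm.compl).comp
      (Config.measurable_restrict hΛm)).subtype_mk

theorem measurable_windowWeight (hH : IsEnergyFunction H) (hΔ : Bornology.IsBounded Δ)
    (hΔm : MeasurableSet Δ) (hΛm : MeasurableSet Λ) :
    Measurable (windowWeight H z β Δ Λ hΛ) := by
  refine Measurable.mul ?_ (measurable_windowBoltzmann hH hΔm hΛm)
  exact (measurable_from_top (f := fun k : ℕ => ENNReal.ofReal z ^ k)).comp
    (Config.measurable_count hΔ hΔm)

/-- The Boltzmann factor of the local energy is jointly measurable in point and configuration. -/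
theorem measurable_boltzmann_localEnergy {X : Type*} [MeasurableSpace X]
    (hH : IsEnergyFunction H) (R β : ℝ) {u : X → Point d} (hu : Measurable u)
    {φ : X → Config d} (hφ : Measurable φ) :
    Measurable fun p => boltzmann β (localEnergy H R (u p) (φ p)) := by
  have h1 : Measurable fun p =>
      (φ p).restrictBounded (Metric.closedBall (u p) R) Metric.isBounded_closedBall := by
    refine measurable_restrictBounded_section hφ
      (fun p => Metric.isBounded_closedBall (x := u p) (r := R)) ?_
    exact measurableSet_le (measurable_snd.dist (hu.comp measurable_fst)) measurable_const
  refine (measurable_boltzmann β).comp (measurable_energySub.comp ((hH.measurable.comp ?_).prodMk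
    (hH.measurable.comp h1)))
  exact (Config.measurable_add h1.subtype_val hu).subtype_mk

end Energy

/-! ### The reduced Campbell measure and removal of points -/

section Campbell

variable {d : ℕ} {P : Measure (Config d)}

/-- The reduced Campbell measure `∑_{x ∈ γ} δ_{(x, γ \ {x})} P(dγ)` has density `r` on `Δ × 𝒞` with
respect to `dx ⊗ P`. -/
def HasCampbellDensity (P : Measure (Config d)) (Δ : Set (Point d))
    (r : Point d → Config d → ℝ≥0∞) : Prop :=
  ∀ f : Point d → Config d → ℝ≥0∞, Measurable (Function.uncurry f) →
    ∫⁻ γ, (∫⁻ x in Δ, f x (γ.erase x) ∂γ.points) ∂P = ∫⁻ γ, (∫⁻ x in Δ, f x γ * r x γ) ∂P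

theorem measurable_uncurry_erase {f : Point d → Config d → ℝ≥0∞}
    (hf : Measurable (Function.uncurry f)) :
    Measurable (Function.uncurry fun (γ : Config d) x => f x (γ.erase x)) :=
  hf.comp (measurable_snd.prodMk (Config.measurable_erase measurable_fst measurable_snd))

theorem Config.measurable_setLIntegral_points {X : Type*} [MeasurableSpace X] {φ : X → Config d}
    (hφ : Measurable φ) {Δ : Set (Point d)} (hΔ : MeasurableSet Δ) {f : X → Point d → ℝ≥0∞}
    (hf : Measurable (Function.uncurry f)) :
    Measurable fun x => ∫⁻ y in Δ, f x y ∂(φ x).points := by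
  simp_rw [setLIntegral_points _ hΔ]
  exact measurable_lintegral_points ((measurable_restrict hΔ).comp hφ) hf

theorem Config.ae_volume_notMem (hd : 0 < d) (γ : Config d) (Δ : Set (Point d)) :
    ∀ᵐ x ∂(volume : Measure (Point d)).restrict Δ, x ∉ γ.carrier := by
  have : Nonempty (Fin d) := ⟨⟨0, hd⟩⟩
  refine ae_restrict_of_ae ?_
  exact compl_mem_ae_iff.2 (γ.countable_carrier.measure_zero _)

theorem HasCampbellDensity.mono {Δ Δ' : Set (Point d)} {r : Point d → Config d → ℝ≥0∞}
    (h : HasCampbellDensity P Δ r) (hΔ' : MeasurableSet Δ') (hsub : Δ' ⊆ Δ) :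
    HasCampbellDensity P Δ' r := by
  intro f hf
  have hf' : Measurable (Function.uncurry fun x γ => Δ'.indicator (fun x => f x γ) x) := by
    have : (Function.uncurry fun x γ => Δ'.indicator (fun x => f x γ) x) =
        (Prod.fst ⁻¹' Δ').indicator (Function.uncurry f) := by
      ext ⟨x, γ⟩; simp only [Function.uncurry, indicator]; rfl
    rw [this]
    exact hf.indicator (measurable_fst hΔ')
  have key := h _ hf'
  have hL : ∀ γ : Config d,
      ∫⁻ x in Δ, Δ'.indicator (fun x' => f x' (γ.erase x)) x ∂γ.points =
        ∫⁻ x in Δ', f x (γ.erase x) ∂γ.points := by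
    intro γ
    rw [← inter_eq_left.2 hsub, ← setLIntegral_indicator hΔ', inter_eq_left.2 hsub]
    rfl
  have hR : ∀ γ : Config d,
      ∫⁻ x in Δ, Δ'.indicator (fun x => f x γ) x * r x γ = ∫⁻ x in Δ', f x γ * r x γ := by
    intro γ
    rw [← inter_eq_left.2 hsub, ← setLIntegral_indicator hΔ', inter_eq_left.2 hsub]
    refine lintegral_congr fun x => ?_
    by_cases hx : x ∈ Δ' <;> simp [hx]
  simpa only [hL, hR] using key

theorem lintegral_eq_tsum_shell (μ : Measure (Point d)) (f : Point d → ℝ≥0∞) :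
    ∫⁻ x, f x ∂μ = ∑' n, ∫⁻ x in Config.shell d n, f x ∂μ := by
  rw [← lintegral_iUnion Config.measurableSet_shell Config.pairwise_disjoint_shell,
    Config.iUnion_shell, Measure.restrict_univ]

theorem HasCampbellDensity.of_shell {r : Point d → Config d → ℝ≥0∞}
    (hr : Measurable (Function.uncurry r))
    (h : ∀ n, HasCampbellDensity P (Config.shell d n) r) :
    HasCampbellDensity P univ r := by
  intro f hf
  have hfr : Measurable (Function.uncurry fun (γ : Config d) x => f x γ * r x γ) :=
    (hf.mul hr).comp measurable_swap
  simp_rw [Measure.restrict_univ]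
  rw [lintegral_congr fun γ : Config d => lintegral_eq_tsum_shell γ.points fun x => f x (γ.erase x),
    lintegral_congr fun γ : Config d => lintegral_eq_tsum_shell volume fun x => f x γ * r x γ,
    lintegral_tsum, lintegral_tsum]
  · exact tsum_congr fun n => h n f hf
  · exact fun n => hfr.lintegral_prod_right'.aemeasurable
  · exact fun n => (Config.measurable_setLIntegral_points measurable_id
      (Config.measurableSet_shell n) (measurable_uncurry_erase hf)).aemeasurable

/-- If `f` vanishes on the support of the density then `f(x, γ \ {x})` vanishes for all points `x` of
almost every `γ`. -/
theorem HasCampbellDensity.ae_eq_zero {Δ : Set (Point d)} (hΔ : MeasurableSet Δ)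
    {r : Point d → Config d → ℝ≥0∞} (h : HasCampbellDensity P Δ r)
    {f : Point d → Config d → ℝ≥0∞} (hf : Measurable (Function.uncurry f))
    (h0 : ∀ᵐ γ ∂P, ∀ x, f x γ * r x γ = 0) :
    ∀ᵐ γ ∂P, ∀ x ∈ γ.carrier, x ∈ Δ → f x (γ.erase x) = 0 := by
  have key := h f hf
  have hR : ∫⁻ γ, (∫⁻ x in Δ, f x γ * r x γ) ∂P = 0 := by
    rw [lintegral_congr_ae (g := fun _ => 0), lintegral_zero]
    filter_upwards [h0] with γ hγ
    simp [hγ]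
  have h0' := (lintegral_eq_zero_iff (Config.measurable_setLIntegral_points measurable_id hΔ
    (measurable_uncurry_erase hf))).1 (key.trans hR)
  filter_upwards [h0'] with γ hγ
  have hm : Measurable fun x => f x (γ.erase x) :=
    (measurable_uncurry_erase hf).comp measurable_prodMk_left
  have h1 := (lintegral_eq_zero_iff hm).1 hγ
  have h2 := (ae_restrict_iff' hΔ).1 h1
  exact (γ.ae_points_iff _).1 h2

/-- Almost sure properties persist when one point is removed. -/
def RemovalStable (P : Measure (Config d)) : Prop :=
  ∀ p : Config d → Prop, (∀ᵐ γ ∂P, p γ) → ∀ᵐ γ ∂P, ∀ x ∈ γ.carrier, p (γ.erase x)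

theorem removalStable_of_hasCampbellDensity {r : ℕ → Point d → Config d → ℝ≥0∞}
    (h : ∀ n : ℕ, HasCampbellDensity P (Metric.closedBall 0 n) (r n)) : RemovalStable P := by
  intro p hp
  set N := toMeasurable P {γ | ¬ p γ} with hN
  have hN0 : P N = 0 := by rw [hN, measure_toMeasurable]; exact hp
  have hNm : MeasurableSet N := measurableSet_toMeasurable _ _
  have hf : Measurable (Function.uncurry fun (_ : Point d) (γ : Config d) =>
      N.indicator (1 : Config d → ℝ≥0∞) γ) :=
    (measurable_one.indicator hNm).comp measurable_snd
  have h1 : ∀ n : ℕ, ∀ᵐ γ ∂P, ∀ x ∈ γ.carrier, x ∈ Metric.closedBall (0 : Point d) n →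
      N.indicator (1 : Config d → ℝ≥0∞) (γ.erase x) = 0 := by
    intro n
    refine (h n).ae_eq_zero Metric.isClosed_closedBall.measurableSet hf ?_
    filter_upwards [compl_mem_ae_iff.2 hN0] with γ hγ x
    rw [indicator_of_notMem hγ, zero_mul]
  filter_upwards [ae_all_iff.2 h1] with γ hγ x hx
  obtain ⟨n, hn⟩ := exists_nat_ge ‖x‖
  have h2 := hγ n x hx (by simpa using hn)
  by_contra hp'
  rw [indicator_of_mem (subset_toMeasurable P _ hp')] at h2
  exact one_ne_zero h2

theorem RemovalStable.finset (h : RemovalStable P) {p : Config d → Prop} (hp : ∀ᵐ γ ∂P, p γ) :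
    ∀ᵐ γ ∂P, ∀ F : Finset (Point d), (F : Set (Point d)) ⊆ γ.carrier →
      p (γ.restrict (F : Set (Point d))ᶜ) := by
  classical
  have hn : ∀ n : ℕ, ∀ᵐ γ ∂P, ∀ F : Finset (Point d), F.card = n →
      (F : Set (Point d)) ⊆ γ.carrier → p (γ.restrict (F : Set (Point d))ᶜ) := by
    intro n
    induction n with
    | zero =>
      filter_upwards [hp] with γ hγ F hF _
      rw [Finset.card_eq_zero] at hF
      have : γ.restrict ((F : Finset (Point d)) : Set (Point d))ᶜ = γ := by
        ext1; change γ.carrier ∩ _ = _; simp [hF]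
      rwa [this]
    | succ n ih =>
      filter_upwards [h _ ih] with γ hγ F hF hsub
      obtain ⟨x, F', hx, rfl, hF'⟩ := Finset.card_eq_succ.1 hF
      rw [Finset.coe_insert, insert_subset_iff] at hsub
      have h1 := hγ x hsub.1 F' hF' (fun y hy => ⟨hsub.2 hy, by rintro rfl; exact hx hy⟩)
      convert h1 using 1
      ext1
      change γ.carrier ∩ _ = γ.carrier \ {x} ∩ _
      ext y
      simp only [Finset.coe_insert, mem_inter_iff, mem_compl_iff, mem_insert_iff, mem_sdiff,
        mem_singleton_iff]
      tauto
  filter_upwards [ae_all_iff.2 hn] with γ hγ F hF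
  exact hγ _ F rfl hF

/-- Every bounded part of the configuration has finite energy. For `β = 0` the energy plays no
role. -/
def LocallyFiniteEnergy (H : FinConfig d → EReal) (β : ℝ) (γ : Config d) : Prop :=
  0 < β → ∀ n : ℕ, H (γ.restrictBounded (Metric.closedBall 0 n) Metric.isBounded_closedBall) ≠ ⊤

theorem LocallyFiniteEnergy.admissible {H : FinConfig d → EReal} (hH : IsEnergyFunction H) {β : ℝ}
    {γ : Config d} (h : LocallyFiniteEnergy H β γ) (Δ : Set (Point d)) {Λ : Set (Point d)}
    (hΛ : Bornology.IsBounded Λ) : Admissible H β Δ Λ hΛ γ := by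
  intro hβ
  obtain ⟨r, hr⟩ := hΛ.subset_closedBall 0
  obtain ⟨n, hn⟩ := exists_nat_ge r
  refine hH.ne_top_of_subset ?_ (h hβ n)
  intro y hy
  exact ⟨hy.1.1, Metric.closedBall_subset_closedBall hn (hr hy.1.2)⟩

end Campbell

/-! ### From the DLR equations to the GNZ equations -/

section Gibbs

variable {d : ℕ} {P : Measure (Config d)}

instance (Δ : Set (Point d)) : SFinite (poissonLaw Δ) := by
  unfold poissonLaw
  infer_instance

theorem Config.erase_splice {Δ : Set (Point d)} {x : Point d} (hx : x ∈ Δ) (γ' γ : Config d) :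
    (splice Δ γ' γ).erase x = splice Δ (γ'.erase x) γ := by
  ext1
  change (γ'.carrier ∩ Δ ∪ γ.carrier ∩ Δᶜ) \ {x} = γ'.carrier \ {x} ∩ Δ ∪ γ.carrier ∩ Δᶜ
  ext y
  simp only [mem_sdiff, mem_union, mem_inter_iff, mem_compl_iff, mem_singleton_iff]
  constructor
  · tauto
  · rintro (h | ⟨h1, h2⟩)
    · tauto
    · exact ⟨Or.inr ⟨h1, h2⟩, by rintro rfl; exact h2 hx⟩

theorem Config.splice_restrict_restrict (Δ : Set (Point d)) (γ : Config d) :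
    splice Δ (γ.restrict Δ) (γ.restrict Δᶜ) = γ := by
  ext1
  change γ.carrier ∩ Δ ∩ Δ ∪ γ.carrier ∩ Δᶜ ∩ Δᶜ = γ.carrier
  rw [inter_assoc, inter_assoc, inter_self, inter_self, inter_union_compl]

theorem Config.splice_restrict_compl (Δ : Set (Point d)) (γ' γ : Config d) :
    splice Δ γ' (γ.restrict Δᶜ) = splice Δ γ' γ := by
  ext1
  change γ'.carrier ∩ Δ ∪ γ.carrier ∩ Δᶜ ∩ Δᶜ = γ'.carrier ∩ Δ ∪ γ.carrier ∩ Δᶜ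
  rw [inter_assoc, inter_self]

theorem Config.add_erase {x : Point d} {γ : Config d} (hx : x ∈ γ.carrier) :
    add x (γ.erase x) = γ := by
  ext1
  change insert x (γ.carrier \ {x}) = γ.carrier
  rw [insert_sdiff_singleton, insert_eq_of_mem hx]

theorem Config.notMem_erase (x : Point d) (γ : Config d) : x ∉ (γ.erase x).carrier :=
  fun h => h.2 rfl

theorem Config.setLIntegral_points_congr (γ : Config d) {Δ : Set (Point d)}
    (hm : MeasurableSet Δ) {f g : Point d → ℝ≥0∞} (h : ∀ x ∈ γ.carrier, x ∈ Δ → f x = g x) :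
    ∫⁻ x in Δ, f x ∂γ.points = ∫⁻ x in Δ, g x ∂γ.points := by
  refine setLIntegral_congr_fun_ae hm ?_
  exact (γ.ae_points_iff _).2 h

/-- The Mecke formula in `Δ` with the configuration outside `Δ` frozen. -/
theorem lintegral_poissonLaw_splice (hd : 0 < d) {Δ : Set (Point d)} (hb : Bornology.IsBounded Δ)
    (hm : MeasurableSet Δ) (γ : Config d) {f : Point d → Config d → ℝ≥0∞}
    (hf : Measurable (Function.uncurry f)) :
    ∫⁻ γ', (∫⁻ x in Δ, f x ((Config.splice Δ γ' γ).erase x) ∂(Config.splice Δ γ' γ).points)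
        ∂poissonLaw Δ =
      ∫⁻ γ', (∫⁻ x in Δ, f x (Config.splice Δ γ' γ)) ∂poissonLaw Δ := by
  have hg : Measurable (Function.uncurry fun x (γ' : Config d) =>
      Δ.indicator (fun x => f x (Config.splice Δ γ' γ)) x) := by
    have : (Function.uncurry fun x (γ' : Config d) =>
        Δ.indicator (fun x => f x (Config.splice Δ γ' γ)) x) =
        (Prod.fst ⁻¹' Δ).indicator fun p : Point d × Config d =>
          f p.1 (Config.splice Δ p.2 γ) := by
      ext ⟨x, γ'⟩; simp only [Function.uncurry, indicator]; rfl
    rw [this]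
    exact (hf.comp (measurable_fst.prodMk
      (Config.measurable_splice hm measurable_snd measurable_const))).indicator (measurable_fst hm)
  have h := Config.lintegral_poissonLaw_mecke hd hb hg
  have hL : ∀ γ' : Config d,
      ∫⁻ x in Δ, f x ((Config.splice Δ γ' γ).erase x) ∂(Config.splice Δ γ' γ).points =
        ∫⁻ x, Δ.indicator (fun x' => f x' (Config.splice Δ (γ'.erase x) γ)) x ∂γ'.points := by
    intro γ'
    rw [Config.setLIntegral_points _ hm, restrict_splice, ← Config.setLIntegral_points _ hm,
      ← lintegral_indicator hm]
    refine lintegral_congr fun x => ?_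
    by_cases hx : x ∈ Δ
    · simp only [indicator_of_mem hx, Config.erase_splice hx]
    · simp only [indicator_of_notMem hx]
  have hR : ∀ γ' : Config d,
      ∫⁻ x in Δ, Δ.indicator (fun x => f x (Config.splice Δ γ' γ)) x =
        ∫⁻ x in Δ, f x (Config.splice Δ γ' γ) := fun γ' => by
    rw [setLIntegral_indicator hm, inter_self]
  simp_rw [hL]
  rw [h]
  simp_rw [hR]

/-- The DLR equations, stated for sets depending on `γ_Δ` and on `γ_{Δᶜ}`, in integrated form. -/
theorem IsGibbsMeasure.lintegral_eq [IsFiniteMeasure P] {H : FinConfig d → EReal} {R z β : ℝ}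
    (hP : IsGibbsMeasure H R z β P) {Δ : Set (Point d)} (hΔ : Bornology.IsBounded Δ)
    (hm : MeasurableSet Δ) (hpos : 0 < volume Δ) {V : Config d → ℝ≥0∞} (hV : Measurable V)
    (hw : ∀ γ γ', gibbsWeight H R z β Δ hΔ γ γ' = V (Config.splice Δ γ' γ))
    {G : Config d → ℝ≥0∞} (hG : Measurable G) :
    ∫⁻ γ, G γ ∂P = ∫⁻ γ, (partitionFunction H R z β Δ hΔ γ)⁻¹ *
      ∫⁻ γ', V (Config.splice Δ γ' γ) * G (Config.splice Δ γ' γ) ∂poissonLaw Δ ∂P := by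
  have hsp : Measurable fun p : Config d × Config d => Config.splice Δ p.2 p.1 :=
    Config.measurable_splice hm measurable_snd measurable_fst
  have hW : Measurable fun p : Config d × Config d => V (Config.splice Δ p.2 p.1) := hV.comp hsp
  have hZ : Measurable (partitionFunction H R z β Δ hΔ) := by
    simp_rw [show partitionFunction H R z β Δ hΔ =
      fun γ => ∫⁻ γ', V (Config.splice Δ γ' γ) ∂poissonLaw Δ from
        funext fun γ => lintegral_congr fun γ' => hw γ γ']
    exact hW.lintegral_prod_right'
  have hD : Measurable fun p : Config d × Config d =>
      (partitionFunction H R z β Δ hΔ p.1)⁻¹ * V (Config.splice Δ p.2 p.1) :=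
    (hZ.comp measurable_fst).inv.mul hW
  have hφ : Measurable fun γ : Config d => (γ.restrict Δ, γ.restrict Δᶜ) :=
    (Config.measurable_restrict hm).prodMk (Config.measurable_restrict hm.compl)
  have hψ : Measurable fun p : Config d × Config d => (p.2, p.1.restrict Δᶜ) :=
    measurable_snd.prodMk ((Config.measurable_restrict hm.compl).comp measurable_fst)
  have hμ : P.map (fun γ => (γ.restrict Δ, γ.restrict Δᶜ)) =
      ((P.prod (poissonLaw Δ)).withDensity fun p =>
        (partitionFunction H R z β Δ hΔ p.1)⁻¹ * V (Config.splice Δ p.2 p.1)).map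
          fun p => (p.2, p.1.restrict Δᶜ) := by
    refine Measure.ext_prod fun {A B} hA hB => ?_
    have hBm : MeasurableSet {γ : Config d | γ.restrict Δᶜ ∈ B} :=
      Config.measurable_restrict hm.compl hB
    rw [Measure.map_apply hφ (hA.prod hB), Measure.map_apply hψ (hA.prod hB),
      withDensity_apply _ (hψ (hA.prod hB))]
    have hpre : (fun p : Config d × Config d => (p.2, p.1.restrict Δᶜ)) ⁻¹' A ×ˢ B =
        {γ : Config d | γ.restrict Δᶜ ∈ B} ×ˢ A := by
      ext p; simp only [mem_preimage, mem_prod]; exact and_comm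
    rw [hpre, ← Measure.prod_restrict, lintegral_prod _ hD.aemeasurable]
    refine (hP Δ hΔ hm hpos A B hA hB).trans (lintegral_congr fun γ => ?_)
    have hWγ : Measurable fun γ' => V (Config.splice Δ γ' γ) := hW.comp measurable_prodMk_left
    rw [gibbsKernel, Measure.smul_apply, smul_eq_mul, withDensity_apply _ hA]
    simp_rw [hw]
    rw [lintegral_const_mul _ hWγ]
  have hF : Measurable fun p : Config d × Config d => G (Config.splice Δ p.1 p.2) :=
    hG.comp (Config.measurable_splice hm measurable_fst measurable_snd)
  have hFψ : Measurable fun p : Config d × Config d =>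
      G (Config.splice Δ p.2 (p.1.restrict Δᶜ)) := hF.comp hψ
  calc ∫⁻ γ, G γ ∂P
      = ∫⁻ p, G (Config.splice Δ p.1 p.2) ∂(P.map fun γ => (γ.restrict Δ, γ.restrict Δᶜ)) := by
        rw [lintegral_map hF hφ]
        simp_rw [Config.splice_restrict_restrict]
    _ = _ := by
        rw [hμ, lintegral_map hF hψ, lintegral_withDensity_eq_lintegral_mul _ hD hFψ,
          lintegral_prod _ (hD.mul hFψ).aemeasurable]
        refine lintegral_congr fun γ => ?_
        have hVG : Measurable fun γ' =>
            V (Config.splice Δ γ' γ) * G (Config.splice Δ γ' γ) :=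
          ((hV.mul hG).comp hsp).comp measurable_prodMk_left
        rw [← lintegral_const_mul _ hVG]
        refine lintegral_congr fun γ' => ?_
        simp only [Pi.mul_apply, Config.splice_restrict_compl, mul_assoc]

/-- Under the DLR equation in `Δ` the reduced Campbell measure on `Δ × 𝒞` has density
`V(γ ∪ {x}) / V(γ)`, where `V` is the Gibbs weight. -/
theorem IsGibbsMeasure.hasCampbellDensity (hd : 0 < d) [IsFiniteMeasure P]
    {H : FinConfig d → EReal} {R z β : ℝ}
    (hP : IsGibbsMeasure H R z β P) {Δ : Set (Point d)} (hΔ : Bornology.IsBounded Δ)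
    (hm : MeasurableSet Δ) (hpos : 0 < volume Δ) {V : Config d → ℝ≥0∞} (hV : Measurable V)
    (hw : ∀ γ γ', gibbsWeight H R z β Δ hΔ γ γ' = V (Config.splice Δ γ' γ))
    (hVt : ∀ γ, V γ ≠ ⊤)
    (hV0 : ∀ x ∈ Δ, ∀ γ : Config d, x ∉ γ.carrier → V γ = 0 → V (Config.add x γ) = 0) :
    HasCampbellDensity P Δ fun x γ => V (Config.add x γ) / V γ := by
  intro f hf
  have hVadd : Measurable fun p : Point d × Config d => V (Config.add p.1 p.2) :=
    hV.comp (Config.measurable_add measurable_snd measurable_fst)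
  have hfr : Measurable fun p : Config d × Point d =>
      f p.2 p.1 * (V (Config.add p.2 p.1) / V p.1) :=
    (hf.comp measurable_swap).mul
      ((hVadd.comp measurable_swap).div (hV.comp measurable_fst))
  have hfe : Measurable fun γ : Config d => ∫⁻ x in Δ, f x (γ.erase x) ∂γ.points :=
    Config.measurable_setLIntegral_points measurable_id hm (measurable_uncurry_erase hf)
  rw [hP.lintegral_eq hΔ hm hpos hV hw hfe,
    hP.lintegral_eq hΔ hm hpos hV hw hfr.lintegral_prod_right']
  refine lintegral_congr fun γ => congrArg _ ?_
  have hg : Measurable (Function.uncurry fun x (η : Config d) => V (Config.add x η) * f x η) :=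
    hVadd.mul hf
  have key := lintegral_poissonLaw_splice hd hΔ hm γ hg
  have hL : ∀ η : Config d, V η * ∫⁻ x in Δ, f x (η.erase x) ∂η.points =
      ∫⁻ x in Δ, V (Config.add x (η.erase x)) * f x (η.erase x) ∂η.points := by
    intro η
    have hfη : Measurable fun x => f x (η.erase x) :=
      (measurable_uncurry_erase hf).comp measurable_prodMk_left
    rw [← lintegral_const_mul _ hfη]
    refine η.setLIntegral_points_congr hm fun x hx _ => ?_
    rw [Config.add_erase hx]
  have hR : ∀ η : Config d, V η * ∫⁻ x in Δ, f x η * (V (Config.add x η) / V η) =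
      ∫⁻ x in Δ, V (Config.add x η) * f x η := by
    intro η
    have hfη : Measurable fun x => f x η * (V (Config.add x η) / V η) :=
      hfr.comp measurable_prodMk_left
    rw [← lintegral_const_mul _ hfη]
    refine lintegral_congr_ae ?_
    filter_upwards [ae_restrict_mem hm, η.ae_volume_notMem hd Δ] with x hx hxη
    have : V η * (V (Config.add x η) / V η) = V (Config.add x η) := by
      by_cases h0 : V η = 0
      · rw [hV0 x hx η hxη h0, h0, zero_mul]
      · exact ENNReal.mul_div_cancel h0 (hVt η)
    rw [mul_left_comm, this, mul_comm]
  calc _ = _ := lintegral_congr fun γ' => hL _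
    _ = _ := key
    _ = _ := lintegral_congr fun γ' => (hR _).symm

/-- Under the DLR equation in `Δ` almost every configuration has positive weight. -/
theorem IsGibbsMeasure.ae_weight_ne_zero [IsFiniteMeasure P] {H : FinConfig d → EReal}
    {R z β : ℝ} (hP : IsGibbsMeasure H R z β P) {Δ : Set (Point d)} (hΔ : Bornology.IsBounded Δ)
    (hm : MeasurableSet Δ) (hpos : 0 < volume Δ) {V : Config d → ℝ≥0∞} (hV : Measurable V)
    (hw : ∀ γ γ', gibbsWeight H R z β Δ hΔ γ γ' = V (Config.splice Δ γ' γ)) :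
    ∀ᵐ γ ∂P, V γ ≠ 0 := by
  have hN : MeasurableSet {γ | V γ = 0} := hV (measurableSet_singleton 0)
  have hG : Measurable ({γ | V γ = 0}.indicator (1 : Config d → ℝ≥0∞)) :=
    measurable_one.indicator hN
  have h := hP.lintegral_eq hΔ hm hpos hV hw hG
  have h0 : ∀ γ : Config d, V γ * {γ | V γ = 0}.indicator (1 : Config d → ℝ≥0∞) γ = 0 := by
    intro γ
    by_cases hγ : V γ = 0
    · rw [hγ, zero_mul]
    · rw [indicator_of_notMem (by exact hγ), mul_zero]
  simp_rw [h0, lintegral_zero, mul_zero, lintegral_zero, lintegral_indicator_one hN] at h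
  exact compl_mem_ae_iff.2 h

/-- The GNZ equations as a statement about the reduced Campbell measure. -/
theorem IsGibbsMeasure.hasCampbellDensity_univ (hd : 0 < d) [IsFiniteMeasure P]
    {H : FinConfig d → EReal} (hH : IsEnergyFunction H) {R : ℝ} (hR : 0 < R)
    (hrange : HasFiniteRange H R) {z β : ℝ} (hz : 0 < z) (hβ : 0 ≤ β)
    (hP : IsGibbsMeasure H R z β P) :
    HasCampbellDensity P univ fun x γ =>
      ENNReal.ofReal z * boltzmann β (localEnergy H R x γ) := by
  -- The sum of two closed balls is a closed ball, so windows of measurable energy are at hand.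
  have hball : ∀ r : ℝ, 0 ≤ r → Metric.closedBall (0 : Point d) r + Metric.closedBall 0 R =
      Metric.closedBall 0 (r + R) := fun r hr => by
    rw [closedBall_add_closedBall hr hR.le, add_zero]
  have hbd : ∀ r : ℝ, Bornology.IsBounded (Metric.closedBall (0 : Point d) r) :=
    fun r => Metric.isBounded_closedBall
  have hms : ∀ r : ℝ, MeasurableSet (Metric.closedBall (0 : Point d) r) :=
    fun r => Metric.isClosed_closedBall.measurableSet
  -- The radius `n + 1` makes the volume positive also for `n = 0`.
  set V : ℕ → Config d → ℝ≥0∞ := fun n => windowWeight H z β (Metric.closedBall 0 (n + 1))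
    (Metric.closedBall 0 (n + 1 + R)) (hbd _) with hVdef
  have hV : ∀ n, Measurable (V n) := fun n => measurable_windowWeight hH (hbd _) (hms _) (hms _)
  have hpos : ∀ n : ℕ, 0 < volume (Metric.closedBall (0 : Point d) (n + 1)) := fun n =>
    Metric.measure_closedBall_pos _ _ (by positivity)
  have hw : ∀ n : ℕ, ∀ γ γ', gibbsWeight H R z β (Metric.closedBall 0 (n + 1)) (hbd _) γ γ' =
      V n (Config.splice (Metric.closedBall 0 (n + 1)) γ' γ) := by
    intro n γ γ'
    refine gibbsWeight_eq_windowWeight _ ?_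
    simp only [deltaEnergy, windowBoltzmann, hball (n + 1) (by positivity)]
  have hpre : ∀ n : ℕ, HasCampbellDensity P (Metric.closedBall 0 (n + 1))
      fun x γ => V n (Config.add x γ) / V n γ := by
    intro n
    refine hP.hasCampbellDensity hd (hbd _) (hms _) (hpos n) (hV n) (hw n)
      (fun γ => windowWeight_ne_top hH hβ γ) fun x hx γ hxγ h0 => ?_
    exact windowWeight_add_eq_zero hH hz hβ
      (Metric.closedBall_subset_closedBall (by linarith)) hx hxγ h0
  have hrem : RemovalStable P := removalStable_of_hasCampbellDensity fun n =>
    (hpre n).mono (hms _) (Metric.closedBall_subset_closedBall (by linarith))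
  have hne : ∀ n, ∀ᵐ γ ∂P, V n γ ≠ 0 := fun n =>
    hP.ae_weight_ne_zero (hbd _) (hms _) (hpos n) (hV n) (hw n)
  have hfin : ∀ᵐ γ ∂P, LocallyFiniteEnergy H β γ := by
    filter_upwards [ae_all_iff.2 fun n => hrem.finset (hne n)] with γ hγ hβ' n htop
    -- Remove all points in the boundary layer: the energy of what remains is `H(γ_Δ) - H(∅)`.
    have hF : (γ.carrier ∩
        (Metric.closedBall 0 (n + 1 + R) \ Metric.closedBall 0 (n + 1))).Finite :=
      γ.finite_inter _ ((hbd _).subset sdiff_subset)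
    have h1 := hγ n hF.toFinset (by rw [hF.coe_toFinset]; exact inter_subset_left)
    rw [hF.coe_toFinset] at h1
    refine h1 ?_
    set γ₁ := γ.restrict (γ.carrier ∩
      (Metric.closedBall 0 (n + 1 + R) \ Metric.closedBall 0 (n + 1)))ᶜ with hγ₁
    refine mul_eq_zero_of_right _ ?_
    have h2 : (γ₁.restrictBounded (Metric.closedBall 0 (n + 1 + R)) (hbd _)).restrict
        (Metric.closedBall 0 (n + 1))ᶜ = FinConfig.empty := by
      refine FinConfig.ext_carrier (Set.eq_empty_iff_forall_notMem.2 ?_)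
      rintro y ⟨⟨⟨h3, h4⟩, h5⟩, h6⟩
      exact h4 ⟨h3, h5, h6⟩
    have h3 : H (γ₁.restrictBounded (Metric.closedBall 0 (n + 1 + R)) (hbd _)) = ⊤ := by
      by_contra hne'
      refine hH.ne_top_of_subset ?_ hne' htop
      rintro y ⟨hy1, hy2⟩
      have hy3 : y ∈ Metric.closedBall (0 : Point d) (n + 1) :=
        Metric.closedBall_subset_closedBall (by linarith) hy2
      exact ⟨⟨hy1, fun h => h.2.2 hy3⟩, Metric.closedBall_subset_closedBall (by linarith) hy2⟩
    rw [windowBoltzmann, deltaEnergyFin, h2, h3]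
    lift H FinConfig.empty to ℝ using ⟨hH.nondegenerate, hH.ne_bot _⟩ with c
    rw [energySub_coe, EReal.top_sub_coe, boltzmann_top hβ']
  have hr : Measurable (Function.uncurry fun x (γ : Config d) =>
      ENNReal.ofReal z * boltzmann β (localEnergy H R x γ)) :=
    measurable_const.mul (measurable_boltzmann_localEnergy hH R β measurable_fst measurable_snd)
  refine HasCampbellDensity.of_shell hr fun n => HasCampbellDensity.mono
    (Δ := Metric.closedBall 0 (n + 1)) (fun f hf => ?_) (Config.measurableSet_shell n) ?_
  · rw [hpre n f hf]
    refine lintegral_congr_ae ?_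
    filter_upwards [hfin, hne n] with γ hγ hVγ
    refine lintegral_congr_ae ?_
    filter_upwards [ae_restrict_mem (hms _), γ.ae_volume_notMem hd _] with x hx hxγ
    have h := windowWeight_add (z := z) hH hR hrange hβ (hbd (n + 1)) (hΛ := hbd (n + 1 + R))
      (hball _ (by positivity)).subset hx hxγ (hγ.admissible hH _ _)
    have h' : V n (Config.add x γ) =
      V n γ * (ENNReal.ofReal z * boltzmann β (localEnergy H R x γ)) := h
    rw [h', mul_comm (V n γ), ENNReal.mul_div_cancel_right hVγ (windowWeight_ne_top hH hβ γ)]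
  · intro y hy
    have h := Nat.lt_floor_add_one ‖y‖
    rw [show ⌊‖y‖⌋₊ = n from hy] at h
    simpa using h.le

end Gibbs

/-! ### From the GNZ equations to the DLR equations -/

section GNZ

variable {d : ℕ} {P : Measure (Config d)}

/-- The GNZ equations for finite-valued functions say that the reduced Campbell measure has density
`z e^{-β h}`. -/
theorem gnz_iff_hasCampbellDensity {H : FinConfig d → EReal} (hH : IsEnergyFunction H)
    (R z β : ℝ) :
    (∀ f : Point d × Config d → ℝ≥0, Measurable f →
      ∫⁻ γ, (∑' x : γ.carrier, (f ((x : Point d), γ.erase x) : ℝ≥0∞)) ∂P =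
        ENNReal.ofReal z *
          ∫⁻ γ, (∫⁻ x : Point d, (f (x, γ) : ℝ≥0∞) * boltzmann β (localEnergy H R x γ)) ∂P) ↔
      HasCampbellDensity P univ fun x γ =>
        ENNReal.ofReal z * boltzmann β (localEnergy H R x γ) := by
  have hb : Measurable fun p : Config d × Point d => boltzmann β (localEnergy H R p.2 p.1) :=
    measurable_boltzmann_localEnergy hH R β measurable_snd measurable_fst
  have hrhs : ∀ f : Point d × Config d → ℝ≥0∞, Measurable f →
      ∫⁻ γ, (∫⁻ x, f (x, γ) * (ENNReal.ofReal z * boltzmann β (localEnergy H R x γ))) ∂P =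
        ENNReal.ofReal z *
          ∫⁻ γ, (∫⁻ x : Point d, f (x, γ) * boltzmann β (localEnergy H R x γ)) ∂P := by
    intro f hf
    have h1 : Measurable fun p : Config d × Point d =>
        f (p.2, p.1) * boltzmann β (localEnergy H R p.2 p.1) := (hf.comp measurable_swap).mul hb
    have h3 : Measurable fun γ : Config d =>
        ∫⁻ x, f (x, γ) * boltzmann β (localEnergy H R x γ) := h1.lintegral_prod_right'
    rw [← lintegral_const_mul _ h3]
    refine lintegral_congr fun γ => ?_
    have h2 : Measurable fun x => f (x, γ) * boltzmann β (localEnergy H R x γ) :=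
      h1.comp measurable_prodMk_left
    rw [← lintegral_const_mul _ h2]
    exact lintegral_congr fun x => mul_left_comm _ _ _
  constructor
  · intro h f hf
    simp only [Measure.restrict_univ]
    set g : ℕ → Point d × Config d → ℝ≥0 := fun n =>
      SimpleFunc.eapproxDiff (Function.uncurry f) n with hg
    have hgm : ∀ n, Measurable (g n) := fun n => SimpleFunc.measurable _
    have hsum : ∀ x γ, f x γ = ∑' n, (g n (x, γ) : ℝ≥0∞) := fun x γ =>
      (SimpleFunc.tsum_eapproxDiff (Function.uncurry f) hf (x, γ)).symm
    have hgm1 : ∀ n, Measurable (Function.uncurry fun (γ : Config d) x =>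
        (g n (x, γ.erase x) : ℝ≥0∞)) := fun n =>
      measurable_uncurry_erase (f := fun x γ => (g n (x, γ) : ℝ≥0∞)) (hgm n).coe_nnreal_ennreal
    have hgm2 : ∀ n, Measurable fun p : Config d × Point d =>
        (g n (p.2, p.1) : ℝ≥0∞) * (ENNReal.ofReal z * boltzmann β (localEnergy H R p.2 p.1)) :=
      fun n => ((hgm n).coe_nnreal_ennreal.comp measurable_swap).mul (measurable_const.mul hb)
    calc _ = ∑' n, ∫⁻ γ, (∫⁻ x, (g n (x, γ.erase x) : ℝ≥0∞) ∂γ.points) ∂P := by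
          have h1 : ∀ n, Measurable fun γ : Config d =>
              ∫⁻ x, (g n (x, γ.erase x) : ℝ≥0∞) ∂γ.points := fun n =>
            Config.measurable_lintegral_points measurable_id (hgm1 n)
          rw [← lintegral_tsum fun n => (h1 n).aemeasurable]
          refine lintegral_congr fun γ => ?_
          have h2 : ∀ n, Measurable fun x => (g n (x, γ.erase x) : ℝ≥0∞) := fun n =>
            (hgm1 n).comp measurable_prodMk_left
          rw [← lintegral_tsum fun n => (h2 n).aemeasurable]
          exact lintegral_congr fun x => hsum _ _
      _ = ∑' n, ∫⁻ γ, (∫⁻ x, (g n (x, γ) : ℝ≥0∞) *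
            (ENNReal.ofReal z * boltzmann β (localEnergy H R x γ))) ∂P := by
          refine tsum_congr fun n => ?_
          rw [hrhs (fun p => (g n p : ℝ≥0∞)) (hgm n).coe_nnreal_ennreal, ← h (g n) (hgm n)]
          exact lintegral_congr fun γ => γ.lintegral_points _
      _ = _ := by
          rw [← lintegral_tsum fun n => (hgm2 n).lintegral_prod_right'.aemeasurable]
          refine lintegral_congr fun γ => ?_
          have h2 : ∀ n, Measurable fun x => (g n (x, γ) : ℝ≥0∞) *
              (ENNReal.ofReal z * boltzmann β (localEnergy H R x γ)) := fun n =>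
            (hgm2 n).comp measurable_prodMk_left
          rw [← lintegral_tsum fun n => (h2 n).aemeasurable]
          refine lintegral_congr fun x => ?_
          rw [hsum, ENNReal.tsum_mul_right]
  · intro h f hf
    have key := h (fun x γ => (f (x, γ) : ℝ≥0∞)) hf.coe_nnreal_ennreal
    simp only [Measure.restrict_univ] at key
    rw [← hrhs (fun p => (f p : ℝ≥0∞)) hf.coe_nnreal_ennreal, ← key]
    exact lintegral_congr fun γ => (γ.lintegral_points fun x => (f (x, γ.erase x) : ℝ≥0∞)).symm

/-- If no point can be left, after removal of other points, with an infinite local energy, then the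
energy is finite: the points of a finite part are inserted one at a time. -/
theorem locallyFiniteEnergy_of_removal {H : FinConfig d → EReal} (hH : IsEnergyFunction H) {R : ℝ}
    (hR : 0 < R) (hrange : HasFiniteRange H R) {β : ℝ} {γ : Config d}
    (h : ∀ F : Finset (Point d), (F : Set (Point d)) ⊆ γ.carrier →
      ∀ x ∈ (γ.restrict (F : Set (Point d))ᶜ).carrier,
        boltzmann β (localEnergy H R x ((γ.restrict (F : Set (Point d))ᶜ).erase x)) ≠ 0) :
    LocallyFiniteEnergy H β γ := by
  classical
  intro hβ n
  have hΛ : Bornology.IsBounded (Metric.closedBall (0 : Point d) (n + R)) :=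
    Metric.isBounded_closedBall
  have hS : ∀ S : Finset (Point d), (S : Set (Point d)) ⊆ γ.carrier ∩ Metric.closedBall 0 n →
      H ⟨Config.ofFinite S S.finite_toSet, S.finite_toSet⟩ ≠ ⊤ := by
    intro S
    induction S using Finset.induction_on with
    | empty =>
      intro _
      convert hH.nondegenerate using 2
      exact FinConfig.ext_carrier Finset.coe_empty
    | insert x S hx ih =>
      intro hsub htop
      rw [Finset.coe_insert, insert_subset_iff] at hsub
      have hfin := ih hsub.2
      have hF : (γ.carrier ∩ (Metric.closedBall 0 (n + R) \ insert x (S : Set (Point d)))).Finite :=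
        γ.finite_inter _ (hΛ.subset sdiff_subset)
      have h1 := h hF.toFinset (by rw [hF.coe_toFinset]; exact inter_subset_left) x
      rw [hF.coe_toFinset] at h1
      refine h1 ⟨hsub.1.1, fun hx' => hx'.2.2 (mem_insert _ _)⟩ ?_
      -- Only `S` and `x` are left in the window `Λ = B(0, n + R)`, which contains `B(x, R)`.
      have hball : Metric.closedBall x R ⊆ Metric.closedBall (0 : Point d) (n + R) := by
        refine Metric.closedBall_subset_closedBall' ?_
        have := Metric.mem_closedBall.1 hsub.1.2
        linarith
      have hnn : Metric.closedBall (0 : Point d) n ⊆ Metric.closedBall (0 : Point d) (n + R) :=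
        Metric.closedBall_subset_closedBall (by linarith)
      set ζ := (γ.restrict (γ.carrier ∩
        (Metric.closedBall 0 (n + R) \ insert x (S : Set (Point d))))ᶜ).erase x with hζ
      have hζS : ζ.restrictBounded _ hΛ =
          ⟨Config.ofFinite S S.finite_toSet, S.finite_toSet⟩ := by
        refine FinConfig.ext_carrier (Subset.antisymm ?_ ?_)
        · rintro y ⟨⟨⟨h2, h3⟩, h4⟩, h5⟩
          by_contra hy
          refine h3 ⟨h2, h5, ?_⟩
          rintro (h6 | h6)
          · exact h4 h6
          · exact hy h6
        · intro y hy
          refine ⟨⟨⟨(hsub.2 hy).1, fun h2 => h2.2.2 (mem_insert_of_mem _ hy)⟩, ?_⟩,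
            hnn (hsub.2 hy).2⟩
          rintro rfl
          exact hx (Finset.mem_coe.1 hy)
      have hins : FinConfig.insert x ⟨Config.ofFinite S S.finite_toSet, S.finite_toSet⟩ =
          ⟨Config.ofFinite (insert x S : Finset (Point d)) (Finset.finite_toSet _),
            Finset.finite_toSet _⟩ :=
        FinConfig.ext_carrier (Finset.coe_insert x S).symm
      rw [localEnergy_eq hrange hΛ hball hR (Config.notMem_erase _ _) (by rwa [hζS]), hζS, hins,
        htop]
      lift H ⟨Config.ofFinite S S.finite_toSet, S.finite_toSet⟩ to ℝ using
        ⟨hfin, hH.ne_bot _⟩ with c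
      rw [energySub_coe, EReal.top_sub_coe, boltzmann_top hβ]
  have hfin := γ.finite_inter (Metric.closedBall 0 n) Metric.isBounded_closedBall
  have h1 := hS hfin.toFinset (by rw [hfin.coe_toFinset])
  convert h1 using 2
  refine FinConfig.ext_carrier ?_
  exact hfin.coe_toFinset.symm

/-- The GNZ equations force the energy to be locally finite almost surely. -/
theorem HasCampbellDensity.ae_locallyFiniteEnergy {H : FinConfig d → EReal}
    (hH : IsEnergyFunction H) {R : ℝ} (hR : 0 < R) (hrange : HasFiniteRange H R) {z β : ℝ}
    (h : HasCampbellDensity P univ fun x γ =>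
      ENNReal.ofReal z * boltzmann β (localEnergy H R x γ)) :
    ∀ᵐ γ ∂P, LocallyFiniteEnergy H β γ := by
  have hrem : RemovalStable P := removalStable_of_hasCampbellDensity fun n =>
    h.mono Metric.isClosed_closedBall.measurableSet (subset_univ _)
  have hm : Measurable fun p : Point d × Config d => boltzmann β (localEnergy H R p.1 p.2) :=
    measurable_boltzmann_localEnergy hH R β measurable_fst measurable_snd
  have hne : ∀ᵐ γ ∂P, ∀ x ∈ γ.carrier, boltzmann β (localEnergy H R x (γ.erase x)) ≠ 0 := by
    have hS := hm (measurableSet_singleton 0)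
    set S := (fun p : Point d × Config d => boltzmann β (localEnergy H R p.1 p.2)) ⁻¹' {0}
    have hf : Measurable (Function.uncurry fun (x : Point d) (γ : Config d) =>
        S.indicator (1 : Point d × Config d → ℝ≥0∞) (x, γ)) := measurable_one.indicator hS
    have h0 := h.ae_eq_zero MeasurableSet.univ hf (Filter.Eventually.of_forall fun γ x => ?_)
    · filter_upwards [h0] with γ hγ x hx hb
      have h1 := hγ x hx (mem_univ x)
      rw [indicator_of_mem (show (x, γ.erase x) ∈ S from hb)] at h1
      exact one_ne_zero h1
    · by_cases hx : (x, γ) ∈ S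
      · have hx' : boltzmann β (localEnergy H R x γ) = 0 := hx
        simp [hx']
      · rw [indicator_of_notMem hx, zero_mul]
  filter_upwards [hrem.finset hne] with γ hγ
  exact locallyFiniteEnergy_of_removal hH hR hrange hγ

/-- Summing over the points of `Δ` counts each configuration with `n + 1` points in `Δ` exactly
`n + 1` times. -/
theorem Config.setLIntegral_points_level {Δ : Set (Point d)} (hΔ : Bornology.IsBounded Δ)
    (hm : MeasurableSet Δ) (n : ℕ) (G : Config d → ℝ≥0∞) (γ : Config d) :
    ∫⁻ x in Δ, {η : Config d | η.count Δ = n}.indicator (fun η => G (add x η)) (γ.erase x)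
        ∂γ.points =
      (n + 1 : ℕ) * {η : Config d | η.count Δ = n + 1}.indicator G γ := by
  have hcount : ∀ x ∈ γ.carrier, x ∈ Δ → (γ.erase x).count Δ + 1 = γ.count Δ := by
    intro x hx hxΔ
    rw [← count_add hΔ hxΔ (notMem_erase x γ), add_erase hx]
  by_cases hγ : γ.count Δ = n + 1
  · rw [indicator_of_mem (by exact hγ),
      γ.setLIntegral_points_congr hm (g := fun _ => G γ) (fun x hx hxΔ => ?_)]
    · rw [setLIntegral_const, points_apply _ hΔ hm, hγ, mul_comm]
    · have h1 := hcount x hx hxΔ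
      rw [indicator_of_mem (by rw [mem_ofPred_eq]; omega), add_erase hx]
  · rw [indicator_of_notMem (by exact hγ), mul_zero,
      γ.setLIntegral_points_congr hm (g := fun _ => 0) (fun x hx hxΔ => ?_), lintegral_zero]
    have h1 := hcount x hx hxΔ
    rw [indicator_of_notMem (by rw [mem_ofPred_eq]; omega)]

theorem Config.measurableSet_level {Δ : Set (Point d)} (hΔ : Bornology.IsBounded Δ)
    (hm : MeasurableSet Δ) (n : ℕ) : MeasurableSet {η : Config d | η.count Δ = n} :=
  measurable_count hΔ hm (measurableSet_singleton n)

theorem Config.measurable_level {Δ : Set (Point d)} (hΔ : Bornology.IsBounded Δ)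
    (hm : MeasurableSet Δ) {G : Config d → ℝ≥0∞} (hG : Measurable G) (n : ℕ) :
    Measurable (Function.uncurry fun x (γ : Config d) =>
      {η : Config d | η.count Δ = n}.indicator (fun η => G (add x η)) γ) := by
  have h : (Function.uncurry fun x (γ : Config d) =>
      {η : Config d | η.count Δ = n}.indicator (fun η => G (add x η)) γ) =
      (Prod.snd ⁻¹' {η : Config d | η.count Δ = n}).indicator
        fun p : Point d × Config d => G (add p.1 p.2) := by
    ext ⟨x, γ⟩
    simp only [Function.uncurry, indicator, mem_preimage]
  rw [h]
  exact (hG.comp (measurable_add measurable_snd measurable_fst)).indicator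
    (measurable_snd (measurableSet_level hΔ hm n))

/-- The recursion in the number of points of `Δ` for a measure whose reduced Campbell measure has a
density. -/
theorem HasCampbellDensity.lintegral_level_succ {Δ : Set (Point d)} (hΔ : Bornology.IsBounded Δ)
    (hm : MeasurableSet Δ) {r : Point d → Config d → ℝ≥0∞} (h : HasCampbellDensity P Δ r)
    {G : Config d → ℝ≥0∞} (hG : Measurable G) (n : ℕ) :
    (n + 1 : ℕ) * ∫⁻ γ, {η : Config d | η.count Δ = n + 1}.indicator G γ ∂P =
      ∫⁻ γ, {η : Config d | η.count Δ = n}.indicator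
        (fun γ => ∫⁻ x in Δ, G (Config.add x γ) * r x γ) γ ∂P := by
  have key := h _ (Config.measurable_level hΔ hm hG n)
  simp_rw [Config.setLIntegral_points_level hΔ hm n G] at key
  rw [lintegral_const_mul _ (hG.indicator (Config.measurableSet_level hΔ hm (n + 1)))] at key
  rw [key]
  refine lintegral_congr fun γ => ?_
  by_cases hγ : γ ∈ {η : Config d | η.count Δ = n}
  · simp only [indicator_of_mem hγ]
  · simp only [indicator_of_notMem hγ, zero_mul, lintegral_zero]

/-- The same recursion for the Gibbs weight with respect to the Poisson point process. -/
theorem lintegral_poissonLaw_level_succ (hd : 0 < d) {Δ : Set (Point d)}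
    (hΔ : Bornology.IsBounded Δ) (hm : MeasurableSet Δ) {r : Point d → Config d → ℝ≥0∞}
    (hr : Measurable (Function.uncurry r)) {V G : Config d → ℝ≥0∞} (hV : Measurable V)
    (hG : Measurable G) (γ : Config d)
    (hVr : ∀ γ' : Config d, ∀ x ∈ Δ, x ∉ (Config.splice Δ γ' γ).carrier →
      V (Config.add x (Config.splice Δ γ' γ)) =
        V (Config.splice Δ γ' γ) * r x (Config.splice Δ γ' γ)) (n : ℕ) :
    (n + 1 : ℕ) * ∫⁻ γ', {η : Config d | η.count Δ = n + 1}.indicator (V * G)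
        (Config.splice Δ γ' γ) ∂poissonLaw Δ =
      ∫⁻ γ', {η : Config d | η.count Δ = n}.indicator
        (V * fun γ => ∫⁻ x in Δ, G (Config.add x γ) * r x γ) (Config.splice Δ γ' γ)
          ∂poissonLaw Δ := by
  have key := lintegral_poissonLaw_splice hd hΔ hm γ
    (Config.measurable_level hΔ hm (hV.mul hG) n)
  simp_rw [Config.setLIntegral_points_level hΔ hm n (V * G)] at key
  have hmeas : Measurable fun γ' : Config d =>
      {η : Config d | η.count Δ = n + 1}.indicator (V * G) (Config.splice Δ γ' γ) :=
    ((hV.mul hG).indicator (Config.measurableSet_level hΔ hm (n + 1))).comp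
        (Config.measurable_splice hm measurable_id measurable_const)
  rw [lintegral_const_mul _ hmeas] at key
  rw [key]
  refine lintegral_congr fun γ' => ?_
  set η := Config.splice Δ γ' γ with hη
  by_cases hγ : η ∈ {η : Config d | η.count Δ = n}
  · simp only [indicator_of_mem hγ, Pi.mul_apply]
    have hGr : Measurable fun x => G (Config.add x η) * r x η :=
      (hG.comp (Config.measurable_add measurable_const measurable_id)).mul
        (hr.comp measurable_prodMk_right)
    rw [← lintegral_const_mul _ hGr]
    refine lintegral_congr_ae ?_
    filter_upwards [ae_restrict_mem hm, η.ae_volume_notMem hd Δ] with x hx hxη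
    rw [hVr γ' x hx hxη]
    ring
  · simp only [indicator_of_notMem hγ, lintegral_zero]

theorem Config.restrict_compl_eq_self {Δ : Set (Point d)} (hΔ : Bornology.IsBounded Δ)
    {γ : Config d} (h : γ.count Δ = 0) : γ.restrict Δᶜ = γ := by
  rw [count, Set.ncard_eq_zero (γ.finite_inter Δ hΔ)] at h
  ext1
  change γ.carrier ∩ Δᶜ = γ.carrier
  rw [← sdiff_eq]
  exact (disjoint_iff_inter_eq_empty.2 h).sdiff_eq_left

theorem Config.splice_empty (Δ : Set (Point d)) (γ : Config d) :
    splice Δ (ofFinite ∅ finite_empty) γ = γ.restrict Δᶜ := by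
  ext1
  change (∅ : Set (Point d)) ∩ Δ ∪ γ.carrier ∩ Δᶜ = γ.carrier ∩ Δᶜ
  rw [empty_inter, empty_union]

/-- A probability measure satisfying the GNZ equations in `Δ` is recovered from its restriction to
the configurations without points in `Δ`. -/
theorem HasCampbellDensity.lintegral_eq (hd : 0 < d) {Δ : Set (Point d)}
    (hΔ : Bornology.IsBounded Δ) (hm : MeasurableSet Δ) {r : Point d → Config d → ℝ≥0∞}
    (hr : Measurable (Function.uncurry r)) (h : HasCampbellDensity P Δ r)
    {V : Config d → ℝ≥0∞} (hV : Measurable V) (hV1 : ∀ γ : Config d, V (γ.restrict Δᶜ) = 1)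
    (hVr : ∀ᵐ γ ∂P, ∀ γ' : Config d, ∀ x ∈ Δ, x ∉ (Config.splice Δ γ' γ).carrier →
      V (Config.add x (Config.splice Δ γ' γ)) =
        V (Config.splice Δ γ' γ) * r x (Config.splice Δ γ' γ))
    {G : Config d → ℝ≥0∞} (hG : Measurable G) :
    ∫⁻ γ, G γ ∂P = ENNReal.ofReal (Real.exp (volume Δ).toReal) *
      ∫⁻ γ in {γ | γ.count Δ = 0},
        ∫⁻ γ', V (Config.splice Δ γ' γ) * G (Config.splice Δ γ' γ) ∂poissonLaw Δ ∂P := by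
  have hE : ∀ n : ℕ, MeasurableSet {η : Config d | η.count Δ = n} :=
    Config.measurableSet_level hΔ hm
  have hsp : Measurable fun p : Config d × Config d => Config.splice Δ p.2 p.1 :=
    Config.measurable_splice hm measurable_snd measurable_fst
  have hlevel : ∀ (n : ℕ) (G : Config d → ℝ≥0∞), Measurable G →
      ∫⁻ γ, {η : Config d | η.count Δ = n}.indicator G γ ∂P =
        ENNReal.ofReal (Real.exp (volume Δ).toReal) * ∫⁻ γ in {γ | γ.count Δ = 0},
          ∫⁻ γ', {η : Config d | η.count Δ = n}.indicator (V * G) (Config.splice Δ γ' γ)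
            ∂poissonLaw Δ ∂P := by
    intro n
    induction n with
    | zero =>
      intro G hG
      have h1 : ∀ γ ∈ {γ : Config d | γ.count Δ = 0},
          ∫⁻ γ', {η : Config d | η.count Δ = 0}.indicator (V * G) (Config.splice Δ γ' γ)
            ∂poissonLaw Δ = ENNReal.ofReal (Real.exp (-(volume Δ).toReal)) * G γ := by
        intro γ hγ
        have hVG : Measurable fun γ' : Config d => (V * G) (Config.splice Δ γ' γ) :=
          (hV.mul hG).comp (hsp.comp measurable_prodMk_left)
        have h2 := Config.lintegral_poissonLaw_count_zero hΔ hm hVG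
        rw [Config.splice_empty, Pi.mul_apply, hV1, one_mul,
          Config.restrict_compl_eq_self hΔ hγ] at h2
        rw [← h2]
        refine lintegral_congr fun γ' => ?_
        simp only [indicator, mem_ofPred_eq, count_splice]
      rw [setLIntegral_congr_fun (hE 0) h1, lintegral_const_mul _ hG, ← mul_assoc,
        ← ENNReal.ofReal_mul (Real.exp_pos _).le, ← Real.exp_add, add_neg_cancel, Real.exp_zero,
        ENNReal.ofReal_one, one_mul, lintegral_indicator (hE 0)]
    | succ n ih =>
      intro G hG
      have hG' : Measurable fun γ : Config d => ∫⁻ x in Δ, G (Config.add x γ) * r x γ :=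
        Measurable.lintegral_prod_right' (f := fun p : Config d × Point d =>
          G (Config.add p.2 p.1) * r p.2 p.1)
          ((hG.comp (Config.measurable_add measurable_fst measurable_snd)).mul
            (hr.comp measurable_swap))
      have hmeas : Measurable fun γ : Config d =>
          ∫⁻ γ', {η : Config d | η.count Δ = n + 1}.indicator (V * G) (Config.splice Δ γ' γ)
            ∂poissonLaw Δ :=
        (((hV.mul hG).indicator (hE (n + 1))).comp hsp).lintegral_prod_right'
      have h1 := (h.lintegral_level_succ hΔ hm hG n).trans (ih _ hG')
      have h2 : ∫⁻ γ in {γ | γ.count Δ = 0},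
          ∫⁻ γ', {η : Config d | η.count Δ = n}.indicator
            (V * fun γ => ∫⁻ x in Δ, G (Config.add x γ) * r x γ) (Config.splice Δ γ' γ)
              ∂poissonLaw Δ ∂P = (n + 1 : ℕ) * ∫⁻ γ in {γ | γ.count Δ = 0},
          ∫⁻ γ', {η : Config d | η.count Δ = n + 1}.indicator (V * G) (Config.splice Δ γ' γ)
            ∂poissonLaw Δ ∂P := by
        rw [← lintegral_const_mul _ hmeas]
        refine lintegral_congr_ae ?_
        filter_upwards [ae_restrict_of_ae hVr] with γ hγ
        exact (lintegral_poissonLaw_level_succ hd hΔ hm hr hV hG γ hγ n).symm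
      rw [h2, mul_left_comm] at h1
      exact (ENNReal.mul_right_inj (by simp) (ENNReal.natCast_ne_top _)).1 h1
  have hdecomp : ∀ (F : Config d → ℝ≥0∞) (η : Config d),
      F η = ∑' n : ℕ, {η : Config d | η.count Δ = n}.indicator F η := by
    intro F η
    rw [tsum_eq_single (η.count Δ)]
    · exact (indicator_of_mem (s := {η' : Config d | η'.count Δ = η.count Δ}) rfl F).symm
    · intro n hn
      exact indicator_of_notMem (s := {η' : Config d | η'.count Δ = n}) hn.symm F
  have hmeas : ∀ n : ℕ, Measurable fun p : Config d × Config d =>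
      {η : Config d | η.count Δ = n}.indicator (V * G) (Config.splice Δ p.2 p.1) := fun n =>
    ((hV.mul hG).indicator (hE n)).comp hsp
  have hmeas' : ∀ n : ℕ, Measurable fun γ : Config d =>
      ∫⁻ γ', {η : Config d | η.count Δ = n}.indicator (V * G) (Config.splice Δ γ' γ)
        ∂poissonLaw Δ := fun n => (hmeas n).lintegral_prod_right'
  rw [lintegral_congr (hdecomp G), lintegral_tsum fun n => (hG.indicator (hE n)).aemeasurable]
  simp_rw [hlevel _ G hG]
  rw [ENNReal.tsum_mul_left, ← lintegral_tsum fun n => (hmeas' n).aemeasurable]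
  congr 1
  refine lintegral_congr fun γ => ?_
  have hmeasγ : ∀ n : ℕ, Measurable fun γ' : Config d =>
      {η : Config d | η.count Δ = n}.indicator (V * G) (Config.splice Δ γ' γ) := fun n =>
    ((hV.mul hG).indicator (hE n)).comp
      (Config.measurable_splice hm measurable_id measurable_const)
  rw [← lintegral_tsum fun n => (hmeasγ n).aemeasurable]
  exact lintegral_congr fun γ' => (hdecomp (V * G) (Config.splice Δ γ' γ)).symm

end GNZ

section Main

variable {d : ℕ} {P : Measure (Config d)}

/-- The GNZ equations imply the DLR equations. -/
theorem HasCampbellDensity.isGibbsMeasure (hd : 0 < d) [IsProbabilityMeasure P]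
    {H : FinConfig d → EReal} (hH : IsEnergyFunction H) {R : ℝ} (hR : 0 < R)
    (hrange : HasFiniteRange H R) {z β : ℝ} (hβ : 0 ≤ β)
    (h : HasCampbellDensity P univ fun x γ =>
      ENNReal.ofReal z * boltzmann β (localEnergy H R x γ)) :
    IsGibbsMeasure H R z β P := by
  intro Δ hΔ hm _ A B hA hB
  -- The sum of `Δ` and a ball need not be a Borel set, so the energy is computed in a large ball.
  obtain ⟨ρ, hρ⟩ :=
    (hΔ.add (Metric.isBounded_closedBall (x := (0 : Point d)) (r := R))).subset_closedBall 0
  have hΛ : Bornology.IsBounded (Metric.closedBall (0 : Point d) ρ) := Metric.isBounded_closedBall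
  set V : Config d → ℝ≥0∞ := windowWeight H z β Δ (Metric.closedBall 0 ρ) hΛ with hVdef
  have hV : Measurable V :=
    measurable_windowWeight hH hΔ hm Metric.isClosed_closedBall.measurableSet
  have hr : Measurable (Function.uncurry fun x (γ : Config d) =>
      ENNReal.ofReal z * boltzmann β (localEnergy H R x γ)) :=
    measurable_const.mul (measurable_boltzmann_localEnergy hH R β measurable_fst measurable_snd)
  have hadm : ∀ᵐ γ ∂P, ∀ γ', Admissible H β Δ _ hΛ (Config.splice Δ γ' γ) := by
    filter_upwards [h.ae_locallyFiniteEnergy hH hR hrange] with γ hγ γ'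
    exact (hγ.admissible hH Δ hΛ).congr (restrict_compl_splice Δ γ' γ)
  have hV1 : ∀ γ : Config d, V (γ.restrict Δᶜ) = 1 := by
    intro γ
    have h0 : (γ.restrict Δᶜ).count Δ = 0 := by
      change (γ.carrier ∩ Δᶜ ∩ Δ).ncard = 0
      rw [inter_assoc, compl_inter_self, inter_empty, Set.ncard_empty]
    rw [hVdef, windowWeight, h0, pow_zero, one_mul, windowBoltzmann_restrict_compl hH]
  have hVr : ∀ᵐ γ ∂P, ∀ γ' : Config d, ∀ x ∈ Δ, x ∉ (Config.splice Δ γ' γ).carrier →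
      V (Config.add x (Config.splice Δ γ' γ)) = V (Config.splice Δ γ' γ) *
        (ENNReal.ofReal z * boltzmann β (localEnergy H R x (Config.splice Δ γ' γ))) := by
    filter_upwards [hadm] with γ hγ γ' x hx hxγ
    exact windowWeight_add hH hR hrange hβ hΔ hρ hx hxγ (hγ γ')
  have key : ∀ {G : Config d → ℝ≥0∞}, Measurable G → _ := fun {G} hG =>
    (h.mono hm (subset_univ _)).lintegral_eq hd hΔ hm hr hV hV1 hVr hG
  have hsp : Measurable fun p : Config d × Config d => Config.splice Δ p.2 p.1 :=
    Config.measurable_splice hm measurable_snd measurable_fst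
  have hVsp : ∀ γ, Measurable fun γ' => V (Config.splice Δ γ' γ) := fun γ =>
    hV.comp (Config.measurable_splice hm measurable_id measurable_const)
  -- `Z` and `I` are measurable versions of the two integrals in the Gibbs kernel of `A`.
  set Z : Config d → ℝ≥0∞ := fun γ => ∫⁻ γ', V (Config.splice Δ γ' γ) ∂poissonLaw Δ with hZ
  set I : Config d → ℝ≥0∞ := fun γ => ∫⁻ γ' in A, V (Config.splice Δ γ' γ) ∂poissonLaw Δ with hI
  have hZm : Measurable Z := (hV.comp hsp).lintegral_prod_right'
  have hIm : Measurable I := (hV.comp hsp).lintegral_prod_right'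
  have hkernel : ∀ᵐ γ ∂P, gibbsKernel H R z β Δ hΔ γ A = (Z γ)⁻¹ * I γ := by
    filter_upwards [hadm] with γ hγ
    have hw : gibbsWeight H R z β Δ hΔ γ = fun γ' => V (Config.splice Δ γ' γ) := funext fun γ' =>
      gibbsWeight_eq_windowWeight hΔ (windowBoltzmann_eq hrange hβ hΔ hρ (hγ γ'))
    rw [gibbsKernel, partitionFunction, hw, Measure.smul_apply, smul_eq_mul,
      withDensity_apply _ hA]
  have hBm : MeasurableSet {γ : Config d | γ.restrict Δᶜ ∈ B} :=
    Config.measurable_restrict hm.compl hB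
  have hAm : MeasurableSet {γ : Config d | γ.restrict Δ ∈ A} := Config.measurable_restrict hm hA
  -- The total mass of `P` is one, so the partition function is finite where it matters.
  have hZfin : ∀ᵐ γ ∂P.restrict {γ | γ.count Δ = 0}, Z γ < ⊤ := by
    refine ae_lt_top hZm fun htop => ?_
    have h1 := key (measurable_const (a := (1 : ℝ≥0∞)))
    simp only [lintegral_const, measure_univ, mul_one] at h1
    rw [show (∫⁻ γ in {γ | γ.count Δ = 0},
        ∫⁻ γ', V (Config.splice Δ γ' γ) ∂poissonLaw Δ ∂P) = ⊤ from htop,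
      ENNReal.mul_top (ENNReal.ofReal_pos.2 (Real.exp_pos _)).ne'] at h1
    exact ENNReal.one_ne_top h1
  have hL : P {γ | γ.restrict Δ ∈ A ∧ γ.restrict Δᶜ ∈ B} =
      ENNReal.ofReal (Real.exp (volume Δ).toReal) * ∫⁻ γ in {γ | γ.count Δ = 0},
        {γ : Config d | γ.restrict Δᶜ ∈ B}.indicator I γ ∂P := by
    rw [show {γ : Config d | γ.restrict Δ ∈ A ∧ γ.restrict Δᶜ ∈ B} =
      {γ | γ.restrict Δ ∈ A} ∩ {γ | γ.restrict Δᶜ ∈ B} from rfl,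
      ← lintegral_indicator_one (hAm.inter hBm), key (measurable_one.indicator (hAm.inter hBm))]
    congr 1
    refine lintegral_congr fun γ => ?_
    by_cases hγ : γ.restrict Δᶜ ∈ B
    · rw [indicator_of_mem (show γ ∈ {γ : Config d | γ.restrict Δᶜ ∈ B} from hγ), hI]
      change _ = ∫⁻ γ' in A, V (Config.splice Δ γ' γ) ∂poissonLaw Δ
      rw [← lintegral_indicator hA]
      refine lintegral_congr_ae ?_
      filter_upwards [Config.ae_poissonLaw_subset hΔ hm] with γ' hγ'
      have h1 : (Config.splice Δ γ' γ).restrict Δ = γ' := by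
        rw [restrict_splice]
        ext1
        exact inter_eq_left.2 hγ'
      by_cases hγA : γ' ∈ A
      · rw [indicator_of_mem hγA, indicator_of_mem, Pi.one_apply, mul_one]
        refine ⟨?_, ?_⟩
        · rw [mem_ofPred_eq, h1]; exact hγA
        · rw [mem_ofPred_eq, restrict_compl_splice]; exact hγ
      · rw [indicator_of_notMem hγA, indicator_of_notMem, mul_zero]
        rintro ⟨h2, -⟩
        rw [mem_ofPred_eq, h1] at h2
        exact hγA h2
    · rw [indicator_of_notMem (show γ ∉ {γ : Config d | γ.restrict Δᶜ ∈ B} from hγ),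
        ← lintegral_zero (μ := poissonLaw Δ)]
      refine lintegral_congr fun γ' => ?_
      rw [indicator_of_notMem, mul_zero]
      rintro ⟨-, h2⟩
      rw [mem_ofPred_eq, restrict_compl_splice] at h2
      exact hγ h2
  have hcomp : ∀ γ γ' : Config d, (Z (Config.splice Δ γ' γ))⁻¹ * I (Config.splice Δ γ' γ) =
      (Z γ)⁻¹ * I γ := by
    intro γ γ'
    have h1 : ∀ γ'', Config.splice Δ γ'' (Config.splice Δ γ' γ) = Config.splice Δ γ'' γ := by
      intro γ''
      rw [← Config.splice_restrict_compl, restrict_compl_splice, Config.splice_restrict_compl]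
    simp only [hZ, hI, h1]
  have hGm : Measurable ({γ : Config d | γ.restrict Δᶜ ∈ B}.indicator
      fun γ => (Z γ)⁻¹ * I γ) := (hZm.inv.mul hIm).indicator hBm
  rw [hL, setLIntegral_congr_fun_ae hBm (hkernel.mono fun γ hγ _ => hγ),
    ← lintegral_indicator hBm, key hGm]
  congr 1
  refine lintegral_congr_ae ?_
  filter_upwards [hZfin] with γ hγZ
  by_cases hγ : γ.restrict Δᶜ ∈ B
  · rw [indicator_of_mem (show γ ∈ {γ : Config d | γ.restrict Δᶜ ∈ B} from hγ)]
    have h1 : ∀ γ', {γ : Config d | γ.restrict Δᶜ ∈ B}.indicator (fun γ => (Z γ)⁻¹ * I γ)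
        (Config.splice Δ γ' γ) = (Z γ)⁻¹ * I γ := by
      intro γ'
      rw [indicator_of_mem, hcomp]
      rw [mem_ofPred_eq, restrict_compl_splice]; exact hγ
    have h2 : I γ = Z γ * ((Z γ)⁻¹ * I γ) := by
      by_cases h0 : Z γ = 0
      · have h3 : I γ ≤ Z γ := setLIntegral_le_lintegral _ _
        rw [h0] at h3 ⊢
        rw [zero_mul]
        exact le_antisymm h3 bot_le
      · rw [← mul_assoc, ENNReal.mul_inv_cancel h0 hγZ.ne, one_mul]
    calc I γ = Z γ * ((Z γ)⁻¹ * I γ) := h2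
      _ = ∫⁻ γ', V (Config.splice Δ γ' γ) * ((Z γ)⁻¹ * I γ) ∂poissonLaw Δ :=
          (lintegral_mul_const _ (hVsp γ)).symm
      _ = _ := lintegral_congr fun γ' => by rw [← h1 γ']
  · rw [indicator_of_notMem (show γ ∉ {γ : Config d | γ.restrict Δᶜ ∈ B} from hγ),
      ← lintegral_zero (μ := poissonLaw Δ)]
    refine lintegral_congr fun γ' => ?_
    rw [indicator_of_notMem, mul_zero]
    rw [mem_ofPred_eq, restrict_compl_splice]; exact hγ

end Main

theorem mainTheorem2 {d : ℕ} (hd : 0 < d) (H : FinConfig d → EReal) (hH : IsEnergyFunction H)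
    (R : ℝ) (hR : 0 < R) (hrange : HasFiniteRange H R) (z β : ℝ) (hz : 0 < z) (hβ : 0 ≤ β)
    (P : Measure (Config d)) [IsProbabilityMeasure P] :
    IsGibbsMeasure H R z β P ↔
      ∀ f : Point d × Config d → ℝ≥0, Measurable f →
        ∫⁻ γ, (∑' x : γ.carrier, (f ((x : Point d), γ.erase x) : ℝ≥0∞)) ∂P =
          ENNReal.ofReal z *
            ∫⁻ γ, (∫⁻ x : Point d, (f (x, γ) : ℝ≥0∞) * boltzmann β (localEnergy H R x γ)) ∂P := by
  rw [gnz_iff_hasCampbellDensity hH]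
  exact ⟨fun h => h.hasCampbellDensity_univ hd hH hR hrange hz hβ,
    fun h => h.isGibbsMeasure hd hH hR hrange hβ⟩
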